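/- **Setting.** Let $K\subseteq\mathbb R^d$ be closed and convex, let $\mathcal X$ be a subset of a metric space with metric $\rho$, and let $\{f(\cdot,x)\}_{x\in\mathcal X}$ be a family of convex, $\beta$-smooth functions over $K$ ($\beta>0$): $f(\cdot,x)$ is convex on $K$ and differentiable at the points of $K$, with $\|\nabla_w f(w,x)-\nabla_w f(w',x)\|\le\beta\|w-w'\|$ for $w,w'\in K$. The gradients are *$L$-input Lipschitz* if $L\ge 0$ and $\|\nabla_w f(w,x)-\nabla_w f(w,x')\|\le L\,\rho(x,x')$ for all $w\in K$, $x,x'\in\mathcal X$. The family is *$G$-Lipschitz* if $G\ge0$ and $|f(w,x)-f(w',x)|\le G\|w-w'\|$ for all $w,w'\in K$, $x\in\mathcal X$. Projected noisy SGD (PNSGD) with step size $\eta$, noise parameter $\sigma$ and start $w_0\in K$ maps a dataset $S=(x_1,\dots,x_n)\in\mathcal X^n$ to the law of $w_n$, where $w_{s+1}=\Pi_K\big(w_s-\eta(\nabla_w f(w_s,x_{s+1})+Z_{s+1})\big)$, the $Z_s\sim\mathcal N(0,\sigma^2 I_d)$ are independent and $\Pi_K$ is the Euclidean projection on $K$.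 For $\alpha>1$ let $D_\alpha(P\|Q)=\frac1{\alpha-1}\log\mathbb E_Q[(dP/dQ)^\alpha]$ ($=\infty$ if $P\not\ll Q$). A randomized learner $\mathcal M$ is *$(\alpha,\varepsilon)$-Rényi DP for its input $t$* if $D_\alpha(\mathcal M(S)\|\mathcal M(S'))\le\varepsilon$, and *$(\alpha,\varepsilon)$-Rényi mDP for its input $t$* if $D_\alpha(\mathcal M(S)\|\mathcal M(S'))\le\varepsilon\,\rho(S,S')$ with $\rho(S,S')=\sum_i\rho(x_i,x_i')$, for all $S,S'\in\mathcal X^n$ that agree outside position $t$. **Statement.** Let $\alpha>1$, $\varepsilon>0$, $1\le t\le n$, $0<\eta\le 2/\beta$ and $w_0\in K$. 1. If $\mathcal X$ is bounded and the gradients are $L$-input Lipschitz, then PNSGD with $\sigma^2\ge\frac{2\alpha L^2\operatorname{diam}(\mathcal X)}{\varepsilon(n-t+1)}$ is $(\alpha,\varepsilon)$-Rényi mDP for its input $t$. 2. If the family is $G$-Lipschitz, then PNSGD with $\sigma^2\ge\frac{2\alpha G^2}{\varepsilon(n-t+1)}$ is $(\alpha,\varepsilon)$-Rényi DP for its input $t$.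 3. If $\mathcal X$ is bounded, the gradients are $L$-input Lipschitz and the family is $G$-Lipschitz, then the noise level in 1 is strictly lower than the one in 2 if and only if $L^2\operatorname{diam}(\mathcal X)<G^2$. In particular it is strictly lower, for every $G$ such that the family is $G$-Lipschitz, whenever the Lipschitz constants scale with the diameter: for some $c>0$ with $\operatorname{diam}(\mathcal X)>(L/c)^2$, every $G$ for which the family is $G$-Lipschitz satisfies $G\ge c\operatorname{diam}(\mathcal X)$. 4. Let $f(w,x)=\frac12\|w-x\|^2$ with $x\in X$, $X\subset\mathbb R^d$ bounded, and $w\in K$, the closed convex hull of $X$ (so $K=X$ if $X$ is closed and convex). This is a family of convex, $1$-smooth functions over $K$ with gradients $w-x$, which are $1$-input Lipschitz, and $G=\operatorname{diam}(X)$ is the smallest number for which the family is $G$-Lipschitz. Hence, for $0<\eta\le2$ and $w_0\in K$, PNSGD is $(\alpha,\varepsilon)$-Rényi mDP for its input $t$ if $\sigma^2\ge\frac{2\alpha\operatorname{diam}(X)}{\varepsilon(n-t+1)}$, and $(\alpha,\varepsilon)$-Rényi DP for its input $t$ if $\sigma^2\ge\frac{2\alpha\operatorname{diam}(X)^2}{\varepsilon(n-t+1)}$.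 The second noise level is $\operatorname{diam}(X)$ times the first; the first is strictly lower if and only if $\operatorname{diam}(X)>1$. -/

import Mathlib

open MeasureTheory ProbabilityTheory

noncomputable section

/-- The Rényi divergence `D_α(μ ‖ ν) = (α - 1)⁻¹ log ∫ (dμ/dν)^α dν` of order `α > 1`,
with value `⊤` when `μ` is not absolutely continuous with respect to `ν`. -/
def renyiDiv {Ω : Type*} [MeasurableSpace Ω] (α : ℝ) (μ ν : Measure Ω) : EReal :=
  open Classical in
  if μ ≪ ν then (((α - 1)⁻¹ : ℝ) : EReal) * ENNReal.log (∫⁻ ω, (μ.rnDeriv ν ω) ^ α ∂ν) else ⊤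

/-- The distance of two datasets of size `n`: the sum of the distances of their entries. -/
def datasetDist {𝒳 : Type*} [MetricSpace 𝒳] {n : ℕ} (S S' : Fin n → 𝒳) : ℝ :=
  ∑ i, dist (S i) (S' i)

/-- `(α, ε)`-Rényi differential privacy of the randomized learner `M` for its input number `t`:
for all datasets with entries in `X` which differ at most in entry `t`, the Rényi divergence of the
output laws is at most `ε`. -/
def RenyiDPAt {𝒳 Ω : Type*} [MeasurableSpace Ω] {n : ℕ} (X : Set 𝒳) (α ε : ℝ) (t : Fin n)
    (M : (Fin n → 𝒳) → Measure Ω) : Prop :=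
  ∀ S S' : Fin n → 𝒳, (∀ i, S i ∈ X) → (∀ i, S' i ∈ X) → (∀ i, i ≠ t → S i = S' i) →
    renyiDiv α (M S) (M S') ≤ (ε : EReal)

/-- `(α, ε)`-Rényi metric differential privacy of the randomized learner `M` for its input number
`t`: for all datasets with entries in `X` which differ at most in entry `t`, the Rényi divergence of
the output laws is at most `ε` times the distance of the datasets. -/
def RenyiMDPAt {𝒳 Ω : Type*} [MetricSpace 𝒳] [MeasurableSpace Ω] {n : ℕ} (X : Set 𝒳) (α ε : ℝ)
    (t : Fin n) (M : (Fin n → 𝒳) → Measure Ω) : Prop :=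
  ∀ S S' : Fin n → 𝒳, (∀ i, S i ∈ X) → (∀ i, S' i ∈ X) → (∀ i, i ≠ t → S i = S' i) →
    renyiDiv α (M S) (M S') ≤ ((ε * datasetDist S S' : ℝ) : EReal)

/-- The Euclidean projection of `v` on `K`: the point of `K` nearest to `v` (which exists and is
unique when `K` is nonempty, closed and convex). -/
def euclProj {d : ℕ} (K : Set (EuclideanSpace ℝ (Fin d))) (v : EuclideanSpace ℝ (Fin d)) :
    EuclideanSpace ℝ (Fin d) :=
  open Classical in
  if h : ∃ θ ∈ K, IsMinOn (fun u => ‖u - v‖) K θ then h.choose else v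

/-- The final iterate of projected noisy stochastic gradient descent, as a function of the dataset
`S` and of the noise vectors `z`. Each step maps `w` to `Π_K (w - η (∇f(w, x) + z))`, where `x`, `z`
are the current data point and the current noise vector, and `g w x` stands for `∇f(w, x)`. -/
def pnsgdRun {𝒳 : Type*} {d : ℕ} (K : Set (EuclideanSpace ℝ (Fin d)))
    (g : EuclideanSpace ℝ (Fin d) → 𝒳 → EuclideanSpace ℝ (Fin d)) (η : ℝ)
    (w₀ : EuclideanSpace ℝ (Fin d)) :
    (n : ℕ) → (Fin n → 𝒳) → (Fin n → EuclideanSpace ℝ (Fin d)) → EuclideanSpace ℝ (Fin d)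
  | 0, _, _ => w₀
  | n + 1, S, z =>
    let w := pnsgdRun K g η w₀ n (Fin.init S) (Fin.init z)
    euclProj K (w - η • (g w (S (Fin.last n)) + z (Fin.last n)))

/-- The output law of projected noisy stochastic gradient descent on the dataset `S`, with
independent noise vectors of law `N(0, σ² I_d)`. -/
def pnsgd {𝒳 : Type*} {d : ℕ} (K : Set (EuclideanSpace ℝ (Fin d)))
    (g : EuclideanSpace ℝ (Fin d) → 𝒳 → EuclideanSpace ℝ (Fin d)) (η σ : ℝ)
    (w₀ : EuclideanSpace ℝ (Fin d)) {n : ℕ} (S : Fin n → 𝒳) :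
    Measure (EuclideanSpace ℝ (Fin d)) :=
  (Measure.pi fun _ : Fin n =>
    multivariateGaussian (0 : EuclideanSpace ℝ (Fin d))
      (σ ^ 2 • (1 : Matrix (Fin d) (Fin d) ℝ))).map (pnsgdRun K g η w₀ n S)

/-- `(f(·, x))_{x ∈ X}` is a family of convex `β`-smooth functions over `K`, with gradients
`g w x = ∇_w f(w, x)`. -/
structure IsConvexSmoothFamily {𝒳 : Type*} {d : ℕ} (K : Set (EuclideanSpace ℝ (Fin d)))
    (X : Set 𝒳) (f : EuclideanSpace ℝ (Fin d) → 𝒳 → ℝ)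
    (g : EuclideanSpace ℝ (Fin d) → 𝒳 → EuclideanSpace ℝ (Fin d)) (β : ℝ) : Prop where
  convexOn : ∀ x ∈ X, ConvexOn ℝ K fun w => f w x
  hasGradient : ∀ x ∈ X, ∀ w ∈ K, HasGradientWithinAt (fun w => f w x) (g w x) K w
  smooth : ∀ x ∈ X, ∀ w ∈ K, ∀ w' ∈ K, ‖g w x - g w' x‖ ≤ β * ‖w - w'‖

/-- The gradients `g w x` are `L`-input Lipschitz: Lipschitz in the data point `x ∈ X`, uniformly
in `w ∈ K`. -/
def IsInputLipschitz {𝒳 : Type*} [MetricSpace 𝒳] {d : ℕ} (K : Set (EuclideanSpace ℝ (Fin d)))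
    (X : Set 𝒳) (g : EuclideanSpace ℝ (Fin d) → 𝒳 → EuclideanSpace ℝ (Fin d)) (L : ℝ) : Prop :=
  0 ≤ L ∧ ∀ w ∈ K, ∀ x ∈ X, ∀ x' ∈ X, ‖g w x - g w x'‖ ≤ L * dist x x'

/-- All functions `f(·, x)` with `x ∈ X` are `G`-Lipschitz on `K`. -/
def IsLipschitzFamily {𝒳 : Type*} {d : ℕ} (K : Set (EuclideanSpace ℝ (Fin d)))
    (X : Set 𝒳) (f : EuclideanSpace ℝ (Fin d) → 𝒳 → ℝ) (G : ℝ) : Prop :=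
  0 ≤ G ∧ ∀ x ∈ X, ∀ w ∈ K, ∀ w' ∈ K, |f w x - f w' x| ≤ G * ‖w - w'‖

/-- The noise level `2 α L² D / (ε (n - t + 1))` for Rényi metric differential privacy of the
input number `t`. Positions are counted from `0` in `Fin n`, so this number is `t + 1` below. -/
def mdpNoise {n : ℕ} (α ε L D : ℝ) (t : Fin n) : ℝ :=
  2 * α * L ^ 2 * D / (ε * ((n : ℝ) - ((t : ℝ) + 1) + 1))

/-- The noise level `2 α G² / (ε (n - t + 1))` for Rényi differential privacy of the input number
`t`. Positions are counted from `0` in `Fin n`, so this number is `t + 1` below. -/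
def rdpNoise {n : ℕ} (α ε G : ℝ) (t : Fin n) : ℝ :=
  2 * α * G ^ 2 / (ε * ((n : ℝ) - ((t : ℝ) + 1) + 1))

end

/-! This is privacy amplification by iteration, in a dual form. Both laws are tested against
nonnegative functions: with `q` conjugate to `α`, the bound `∫ φ dμ ≤ C (∫ φ^q dν)^(1/q)` for all
`φ` controls `D_α`, as testing with powers of `dμ/dν` shows. A Gaussian shifted by `b` satisfies it
with `C = exp ((α-1)‖b‖²/(2σ²))`.

Two runs agree until the differing input is read; there the centers of the next iterates separate by
at most `ηΔ`, where `Δ` bounds the gradient difference. Later gradient steps and projections are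
nonexpansive, so the gap never grows, and each of the `m` noise draws from that step on can absorb a
share `ηΔ/m` of it by shifting its Gaussian by `Δ/m`. The costs add up to `D_α ≤ αΔ²/(2σ²m)`.
`lintegral_pnsgd_le` carries this out backwards from the last iterate. Then `Δ = Lρ` yields the
metric guarantee and `Δ = 2G` the other one.

Nonexpansiveness needs care: `K` may have empty interior, and nothing is known off `K`. Projection
onto `K` ignores the part of the gradient normal to the affine span of `K`. For the tangential part,
cocoercivity holds between close points with room around them in `K`; chaining along segments and a
limit from the relative interior give `norm_gradient_step_sub_le`. -/

open scoped ENNReal RealInnerProductSpace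

/-! ### Hölder domination as a dual form of Rényi divergence -/

/-- `μ` is dominated by `ν` in the sense of Hölder's inequality with exponent `q` and constant `C`.
For densities `h = dμ/dν`, the best constant is the `L^p(ν)`-norm of `h`, `p` conjugate to `q`. -/
def HolderDominated {Ω : Type*} [MeasurableSpace Ω] (q : ℝ) (C : ℝ≥0∞) (μ ν : Measure Ω) : Prop :=
  ∀ φ : Ω → ℝ≥0∞, Measurable φ → ∫⁻ ω, φ ω ∂μ ≤ C * (∫⁻ ω, φ ω ^ q ∂ν) ^ (1 / q)

theorem lintegral_le_lintegral_rpow {Ω : Type*} [MeasurableSpace Ω] {q : ℝ} (hq : 1 < q)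
    (μ : Measure Ω) [IsProbabilityMeasure μ] {φ : Ω → ℝ≥0∞} (hφ : Measurable φ) :
    ∫⁻ ω, φ ω ∂μ ≤ (∫⁻ ω, φ ω ^ q ∂μ) ^ (1 / q) := by
  have h := ENNReal.lintegral_mul_le_Lp_mul_Lq μ (Real.HolderConjugate.conjExponent hq)
    hφ.aemeasurable (g := fun _ => 1) aemeasurable_const
  simpa using h

theorem HolderDominated.refl {Ω : Type*} [MeasurableSpace Ω] {q : ℝ} (hq : 1 < q)
    (μ : Measure Ω) [IsProbabilityMeasure μ] : HolderDominated q 1 μ μ := fun φ hφ => by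
  simpa using lintegral_le_lintegral_rpow hq μ hφ

theorem HolderDominated.absolutelyContinuous {Ω : Type*} [MeasurableSpace Ω] {q : ℝ} (hq : 1 < q)
    {C : ℝ≥0∞} {μ ν : Measure Ω} (h : HolderDominated q C μ ν) : μ ≪ ν := by
  have hq0 : 0 < q := by linarith
  refine Measure.AbsolutelyContinuous.mk fun s hs h0 => ?_
  have h1 := h (s.indicator 1) (measurable_one.indicator hs)
  have h2 : ∀ ω, (s.indicator (1 : Ω → ℝ≥0∞) ω) ^ q = s.indicator 1 ω := fun ω => by
    by_cases hω : ω ∈ s <;> simp [hω, hq0]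
  simp only [h2, lintegral_indicator_one hs, h0] at h1
  rw [ENNReal.zero_rpow_of_pos (by positivity), mul_zero] at h1
  exact le_antisymm h1 zero_le

/-- Testing with `r^(α-1)`, `r = dμ/dν`, gives `A ≤ C * A^(1/q)` for `A = ∫ r^α dν`, hence `A ≤
C^α`. -/
theorem HolderDominated.lintegral_rnDeriv_rpow_le {Ω : Type*} [MeasurableSpace Ω] {α q : ℝ}
    (hαq : α.HolderConjugate q) {C : ℝ≥0∞} {μ ν : Measure Ω} [IsFiniteMeasure μ]
    [IsFiniteMeasure ν] (h : HolderDominated q C μ ν) :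
    ∫⁻ ω, (μ.rnDeriv ν ω) ^ α ∂ν ≤ C ^ α := by
  have hα := hαq.lt
  have hac := h.absolutelyContinuous hαq.symm.lt
  set r := μ.rnDeriv ν with hr
  have hrm : Measurable r := Measure.measurable_rnDeriv μ ν
  -- Truncating the density at `n` makes the integral finite, so that `A^(1/q)` can be cancelled;
  -- Fatou's lemma removes the truncation.
  have key : ∀ n : ℕ, ∫⁻ ω, (min (r ω) n) ^ α ∂ν ≤ C ^ α := fun n => by
    set A := ∫⁻ ω, (min (r ω) n) ^ α ∂ν with hA
    have hAtop : A ≠ ⊤ := by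
      refine ne_top_of_le_ne_top (b := ∫⁻ _, (n : ℝ≥0∞) ^ α ∂ν) ?_
        (lintegral_mono fun ω => ENNReal.rpow_le_rpow (min_le_right _ _) (by linarith))
      rw [lintegral_const]
      exact ENNReal.mul_ne_top (ENNReal.rpow_ne_top_of_nonneg (by linarith)
        (ENNReal.natCast_ne_top n)) (measure_ne_top _ _)
    have h1 : A ≤ C * A ^ (1 / q) := by
      have h2 := h (fun ω => (min (r ω) n) ^ (α - 1)) (by fun_prop)
      have h3 : ∀ ω, ((min (r ω) (n : ℝ≥0∞)) ^ (α - 1)) ^ q = (min (r ω) n) ^ α := fun ω => by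
        rw [← ENNReal.rpow_mul, hαq.sub_one_mul_conj]
      simp only [h3] at h2
      refine le_trans ?_ h2
      rw [← lintegral_rnDeriv_mul hac (by fun_prop)]
      refine lintegral_mono fun ω => ?_
      calc (min (r ω) (n : ℝ≥0∞)) ^ α
          = (min (r ω) (n : ℝ≥0∞)) ^ (1 + (α - 1)) := by ring_nf
        _ = min (r ω) (n : ℝ≥0∞) * (min (r ω) (n : ℝ≥0∞)) ^ (α - 1) := by
          rw [ENNReal.rpow_add_of_nonneg _ _ zero_le_one (by linarith), ENNReal.rpow_one]
        _ ≤ _ := by gcongr; exact min_le_left _ _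
    rcases eq_or_ne A 0 with h0 | h0
    · rw [h0]; exact zero_le
    have h4 : A ^ (1 / α) ≤ C := by
      have h5 : A = A ^ (1 / α) * A ^ (1 / q) := by
        rw [← ENNReal.rpow_add _ _ h0 hAtop]
        have := hαq.inv_add_inv_eq_one
        rw [one_div, one_div, this, ENNReal.rpow_one]
      have h6 : A ^ (1 / q) ≠ 0 := by
        simp [ENNReal.rpow_eq_zero_iff, h0, hAtop]
      have h7 : A ^ (1 / q) ≠ ⊤ :=
        ENNReal.rpow_ne_top_of_nonneg (by have := hαq.symm.pos; positivity) hAtop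
      exact (ENNReal.mul_le_mul_iff_left h6 h7).1 (h5.symm.trans_le h1)
    calc A = (A ^ (1 / α)) ^ α := by
          rw [← ENNReal.rpow_mul, one_div, inv_mul_cancel₀ (by linarith), ENNReal.rpow_one]
      _ ≤ C ^ α := by gcongr
  have hlim : ∀ ω, Filter.Tendsto (fun n : ℕ => (min (r ω) (n : ℝ≥0∞)) ^ α) Filter.atTop
      (nhds (r ω ^ α)) := fun ω => by
    have h1 : Filter.Tendsto (fun n : ℕ => min (r ω) (n : ℝ≥0∞)) Filter.atTop (nhds (r ω)) := by
      simpa using (tendsto_const_nhds (x := r ω)).min ENNReal.tendsto_nat_nhds_top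
    exact (ENNReal.continuous_rpow_const.tendsto _).comp h1
  calc ∫⁻ ω, r ω ^ α ∂ν
      = ∫⁻ ω, Filter.liminf (fun n : ℕ => (min (r ω) (n : ℝ≥0∞)) ^ α) Filter.atTop ∂ν := by
        simp only [(hlim _).liminf_eq]
    _ ≤ Filter.liminf (fun n : ℕ => ∫⁻ ω, (min (r ω) (n : ℝ≥0∞)) ^ α ∂ν) Filter.atTop :=
        lintegral_liminf_le fun n => by fun_prop
    _ ≤ C ^ α := by
        refine Filter.liminf_le_of_le (by isBoundedDefault) fun b hb => ?_
        obtain ⟨n, hn⟩ := hb.exists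
        exact hn.trans (key n)

theorem HolderDominated.renyiDiv_le {Ω : Type*} [MeasurableSpace Ω] {α q : ℝ}
    (hαq : α.HolderConjugate q) {c : ℝ} {μ ν : Measure Ω} [IsFiniteMeasure μ]
    [IsFiniteMeasure ν] (h : HolderDominated q (ENNReal.ofReal (Real.exp c)) μ ν) :
    renyiDiv α μ ν ≤ (((α - 1)⁻¹ * (c * α) : ℝ) : EReal) := by
  have hα := hαq.lt
  rw [renyiDiv, if_pos (h.absolutelyContinuous hαq.symm.lt), EReal.coe_mul]
  refine mul_le_mul_of_nonneg_left ?_ (by exact_mod_cast inv_nonneg.2 (by linarith))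
  refine (ENNReal.log_le_log (h.lintegral_rnDeriv_rpow_le hαq)).trans ?_
  rw [ENNReal.ofReal_rpow_of_pos (Real.exp_pos c), ← Real.exp_mul,
    ENNReal.log_ofReal_of_pos (Real.exp_pos _), Real.log_exp]

theorem HolderDominated.map {Ω Ω' : Type*} [MeasurableSpace Ω] [MeasurableSpace Ω'] {q : ℝ}
    {C : ℝ≥0∞} {μ ν : Measure Ω} (h : HolderDominated q C μ ν) {F : Ω → Ω'} (hF : Measurable F) :
    HolderDominated q C (μ.map F) (ν.map F) := fun φ hφ => by
  rw [lintegral_map hφ hF, lintegral_map (hφ.pow_const q) hF]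
  exact h _ (hφ.comp hF)

/-- Constants multiply because domination on the fibres produces a `1/q`-th power, which the
exponent `q` of the outer domination undoes. -/
theorem HolderDominated.prod {Ω Ω' : Type*} [MeasurableSpace Ω] [MeasurableSpace Ω'] {q : ℝ}
    (hq : 0 < q) {C C' : ℝ≥0∞} {μ ν : Measure Ω} {μ' ν' : Measure Ω'} [SFinite μ'] [SFinite ν']
    (h : HolderDominated q C μ ν) (h' : HolderDominated q C' μ' ν') :
    HolderDominated q (C' * C) (μ.prod μ') (ν.prod ν') := fun φ hφ => by
  have hm : Measurable fun x => ∫⁻ y, φ (x, y) ^ q ∂ν' := (hφ.pow_const q).lintegral_prod_right'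
  rw [lintegral_prod _ hφ.aemeasurable, lintegral_prod _ (hφ.pow_const q).aemeasurable]
  calc ∫⁻ x, ∫⁻ y, φ (x, y) ∂μ' ∂μ
      ≤ ∫⁻ x, C' * (∫⁻ y, φ (x, y) ^ q ∂ν') ^ (1 / q) ∂μ :=
        lintegral_mono fun x => h' _ (hφ.comp measurable_prodMk_left)
    _ = C' * ∫⁻ x, (∫⁻ y, φ (x, y) ^ q ∂ν') ^ (1 / q) ∂μ :=
        lintegral_const_mul _ (hm.pow_const _)
    _ ≤ C' * (C * (∫⁻ x, ((∫⁻ y, φ (x, y) ^ q ∂ν') ^ (1 / q)) ^ q ∂ν) ^ (1 / q)) := by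
        gcongr; exact h _ (hm.pow_const _)
    _ = _ := by
        simp only [← ENNReal.rpow_mul, one_div, inv_mul_cancel₀ hq.ne', ENNReal.rpow_one, mul_assoc]

theorem HolderDominated.pi {Ω : Type*} [MeasurableSpace Ω] {q : ℝ} (hq : 1 < q) {d : ℕ}
    {C : Fin d → ℝ≥0∞} {μ ν : Fin d → Measure Ω} [∀ i, SigmaFinite (μ i)] [∀ i, SigmaFinite (ν i)]
    (h : ∀ i, HolderDominated q (C i) (μ i) (ν i)) :
    HolderDominated q (∏ i, C i) (Measure.pi μ) (Measure.pi ν) := by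
  induction d with
  | zero =>
    rw [Measure.pi_of_empty μ (fun i => i.elim0), Measure.pi_of_empty ν (fun i => i.elim0)]
    simpa using HolderDominated.refl hq (Measure.dirac fun i : Fin 0 => (i.elim0 : Ω))
  | succ d ih =>
    rw [← (measurePreserving_piFinSuccAbove μ 0).symm.map_eq,
      ← (measurePreserving_piFinSuccAbove ν 0).symm.map_eq, Fin.prod_univ_succ, mul_comm]
    refine HolderDominated.map ?_ (MeasurableEquiv.measurable _)
    exact (h 0).prod (by linarith) (ih fun i => h i.succ)

/-! ### Gaussian shifts -/

theorem gaussianPDFReal_one_eq_mul_exp (b x : ℝ) :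
    gaussianPDFReal b 1 x = gaussianPDFReal 0 1 x * Real.exp (b * x - b ^ 2 / 2) := by
  simp only [gaussianPDFReal, mul_assoc, ← Real.exp_add, NNReal.coe_one]
  ring_nf

/-- Hölder's inequality applied to the density `exp (b x - b²/2)`, whose `L^α` norm comes from the
Gaussian moment generating function. -/
theorem holderDominated_gaussianReal {α q : ℝ} (hαq : α.HolderConjugate q) (b : ℝ) :
    HolderDominated q (ENNReal.ofReal (Real.exp ((α - 1) * b ^ 2 / 2)))
      (gaussianReal b 1) (gaussianReal 0 1) := fun φ hφ => by
  have hα := hαq.pos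
  set e : ℝ → ℝ≥0∞ := fun x => ENNReal.ofReal (Real.exp (b * x - b ^ 2 / 2)) with he
  have hem : Measurable e := by fun_prop
  have h1 : ∫⁻ x, φ x ∂gaussianReal b 1 = ∫⁻ x, e x * φ x ∂gaussianReal 0 1 := by
    change ∫⁻ x, φ x ∂_ = ∫⁻ x, (e * φ) x ∂_
    rw [gaussianReal_of_var_ne_zero _ one_ne_zero, gaussianReal_of_var_ne_zero _ one_ne_zero,
      lintegral_withDensity_eq_lintegral_mul _ (measurable_gaussianPDF _ _) hφ,
      lintegral_withDensity_eq_lintegral_mul _ (measurable_gaussianPDF _ _) (hem.mul hφ)]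
    refine lintegral_congr fun x => ?_
    simp only [Pi.mul_apply, gaussianPDF, he, gaussianPDFReal_one_eq_mul_exp b x, ← mul_assoc]
    rw [ENNReal.ofReal_mul (gaussianPDFReal_nonneg _ _ _)]
  have h2 : ∫⁻ x, e x ^ α ∂gaussianReal 0 1
      = ENNReal.ofReal (Real.exp ((α - 1) * b ^ 2 / 2)) ^ α := by
    have h3 : ∀ x, e x ^ α = ENNReal.ofReal (Real.exp (-(α * b ^ 2 / 2)))
        * ENNReal.ofReal (Real.exp (α * b * x)) := fun x => by
      rw [he, ENNReal.ofReal_rpow_of_pos (Real.exp_pos _), ← Real.exp_mul,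
        ← ENNReal.ofReal_mul (Real.exp_pos _).le, ← Real.exp_add]
      ring_nf
    simp only [h3]
    rw [lintegral_const_mul _ (by fun_prop), ← ofReal_integral_eq_lintegral_ofReal
      (integrable_exp_mul_gaussianReal _) (ae_of_all _ fun x => (Real.exp_pos _).le)]
    have h4 := congrFun (mgf_fun_id_gaussianReal (μ := 0) (v := 1)) (α * b)
    rw [mgf] at h4
    rw [h4, ← ENNReal.ofReal_mul (Real.exp_pos _).le, ← Real.exp_add,
      ENNReal.ofReal_rpow_of_pos (Real.exp_pos _), ← Real.exp_mul]
    congr 2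
    simp only [NNReal.coe_one]
    ring
  rw [h1]
  refine (ENNReal.lintegral_mul_le_Lp_mul_Lq _ hαq hem.aemeasurable hφ.aemeasurable).trans ?_
  rw [h2, ← ENNReal.rpow_mul, one_div α, mul_inv_cancel₀ hα.ne', ENNReal.rpow_one]

/-- Reduces isotropic noise to independent coordinates, by comparing characteristic functions; `σ =
0` is included. -/
theorem multivariateGaussian_zero_sq_smul_one {d : ℕ} (σ : ℝ) :
    multivariateGaussian (0 : EuclideanSpace ℝ (Fin d)) (σ ^ 2 • (1 : Matrix (Fin d) (Fin d) ℝ))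
      = (Measure.pi fun _ : Fin d => gaussianReal 0 1).map
          fun x => σ • (WithLp.toLp 2 x : EuclideanSpace ℝ (Fin d)) := by
  have h0 : (fun x : Fin d → ℝ => σ • (WithLp.toLp 2 x : EuclideanSpace ℝ (Fin d)))
    = (fun x => σ • x) ∘ WithLp.toLp 2 := rfl
  rw [h0, ← Measure.map_map (by fun_prop) (by fun_prop), map_pi_eq_stdGaussian]
  refine Measure.ext_of_charFun (funext fun t => ?_)
  have hS : (σ ^ 2 • (1 : Matrix (Fin d) (Fin d) ℝ)).PosSemidef :=
    Matrix.PosSemidef.one.smul (sq_nonneg σ)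
  rw [charFun_multivariateGaussian hS, charFun_map_smul, charFun_stdGaussian]
  congr 1
  have h1 : (t.ofLp ⬝ᵥ (σ ^ 2 • (1 : Matrix (Fin d) (Fin d) ℝ)).mulVec t.ofLp : ℝ)
      = ‖σ • t‖ ^ 2 := by
    rw [Matrix.smul_mulVec, Matrix.one_mulVec, dotProduct_smul, norm_smul, mul_pow,
      EuclideanSpace.real_norm_sq_eq]
    simp [dotProduct, sq]
  rw [h1]
  simp
  ring

theorem holderDominated_multivariateGaussian_map_add {d : ℕ} {α q : ℝ}
    (hαq : α.HolderConjugate q) (σ : ℝ) (b : EuclideanSpace ℝ (Fin d)) (hb : σ = 0 → b = 0) :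
    HolderDominated q (ENNReal.ofReal (Real.exp ((α - 1) * ‖b‖ ^ 2 / (2 * σ ^ 2))))
      ((multivariateGaussian (0 : EuclideanSpace ℝ (Fin d))
        (σ ^ 2 • (1 : Matrix (Fin d) (Fin d) ℝ))).map (· + b))
      (multivariateGaussian (0 : EuclideanSpace ℝ (Fin d))
        (σ ^ 2 • (1 : Matrix (Fin d) (Fin d) ℝ))) := by
  -- Without noise only the zero shift is allowed, and the constant is `exp 0 = 1`.
  by_cases hσ : σ = 0
  · simpa [hb hσ] using HolderDominated.refl hαq.symm.lt _
  rw [multivariateGaussian_zero_sq_smul_one, Measure.map_map (by fun_prop) (by fun_prop)]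
  have h1 : ((fun x : EuclideanSpace ℝ (Fin d) => x + b) ∘ fun x : Fin d → ℝ =>
      σ • (WithLp.toLp 2 x : EuclideanSpace ℝ (Fin d)))
      = (fun x : Fin d → ℝ => σ • (WithLp.toLp 2 x : EuclideanSpace ℝ (Fin d))) ∘
        fun x i => x i + b i / σ := by
    ext x i
    simp only [Function.comp_apply, PiLp.add_apply, PiLp.smul_apply, smul_eq_mul]
    field_simp
  rw [h1, ← Measure.map_map (by fun_prop) (by fun_prop)]
  refine HolderDominated.map ?_ (by fun_prop)
  rw [Measure.pi_map_pi fun i => (measurable_add_const (b i / σ)).aemeasurable]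
  simp only [gaussianReal_map_add_const, zero_add]
  have h2 : ENNReal.ofReal (Real.exp ((α - 1) * ‖b‖ ^ 2 / (2 * σ ^ 2)))
      = ∏ i, ENNReal.ofReal (Real.exp ((α - 1) * (b i / σ) ^ 2 / 2)) := by
    rw [← ENNReal.ofReal_prod_of_nonneg fun i _ => (Real.exp_pos _).le, ← Real.exp_sum,
      EuclideanSpace.real_norm_sq_eq, Finset.mul_sum, Finset.sum_div]
    congr 3 with i
    field_simp
  rw [h2]
  exact HolderDominated.pi hαq.symm.lt fun i => holderDominated_gaussianReal hαq _

/-! ### Euclidean projection onto a closed convex set -/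

section Projection

variable {d : ℕ} {K : Set (EuclideanSpace ℝ (Fin d))}

theorem euclProj_spec (hc : IsClosed K) (hK : Convex ℝ K) (hne : K.Nonempty)
    (v : EuclideanSpace ℝ (Fin d)) :
    euclProj K v ∈ K ∧ ∀ w ∈ K, ⟪v - euclProj K v, w - euclProj K v⟫ ≤ 0 := by
  have hex : ∃ θ ∈ K, IsMinOn (fun u => ‖u - v‖) K θ := by
    obtain ⟨θ, hθ, h⟩ := exists_norm_eq_iInf_of_complete_convex hne hc.isComplete hK v
    refine ⟨θ, hθ, fun u hu => ?_⟩
    have h1 : (⨅ w : K, ‖v - w‖) ≤ ‖v - u‖ :=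
      ciInf_le ⟨0, by rintro _ ⟨w, rfl⟩; exact norm_nonneg _⟩ (⟨u, hu⟩ : K)
    change ‖θ - v‖ ≤ ‖u - v‖
    rw [norm_sub_rev θ, norm_sub_rev u]
    exact h.trans_le h1
  rw [euclProj, dif_pos hex]
  obtain ⟨h1, h2⟩ := hex.choose_spec
  refine ⟨h1, (norm_eq_iInf_iff_real_inner_le_zero hK h1).1 ?_⟩
  have : Nonempty K := hne.to_subtype
  refine le_antisymm (le_ciInf fun w => ?_)
    (ciInf_le ⟨0, by rintro _ ⟨w, rfl⟩; exact norm_nonneg _⟩ (⟨_, h1⟩ : K))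
  rw [norm_sub_rev v, norm_sub_rev v]
  exact h2 w.2

theorem euclProj_mem (hc : IsClosed K) (hK : Convex ℝ K) (hne : K.Nonempty)
    (v : EuclideanSpace ℝ (Fin d)) : euclProj K v ∈ K :=
  (euclProj_spec hc hK hne v).1

/-- Adding the variational inequalities of the two projections gives `‖p - p'‖² ≤ ⟪v - v', p - p'⟫`;
Cauchy–Schwarz finishes. -/
theorem norm_euclProj_sub_le (hc : IsClosed K) (hK : Convex ℝ K) (hne : K.Nonempty)
    (v v' : EuclideanSpace ℝ (Fin d)) : ‖euclProj K v - euclProj K v'‖ ≤ ‖v - v'‖ := by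
  obtain ⟨h1, h2⟩ := euclProj_spec hc hK hne v
  obtain ⟨h1', h2'⟩ := euclProj_spec hc hK hne v'
  set p := euclProj K v
  set p' := euclProj K v'
  have h3 := h2 p' h1'
  have h4 := h2' p h1
  have h5 : ‖p - p'‖ ^ 2 ≤ ⟪v - v', p - p'⟫ := by
    rw [← real_inner_self_eq_norm_sq]
    have e : ⟪v - v', p - p'⟫ - ⟪p - p', p - p'⟫ = -⟪v - p, p' - p⟫ - ⟪v' - p', p - p'⟫ := by
      simp only [inner_sub_left, inner_sub_right]; ring
    linarith
  have h6 := real_inner_le_norm (v - v') (p - p')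
  by_contra! h7
  have h8 : 0 < ‖p - p'‖ := (norm_nonneg _).trans_lt h7
  nlinarith

theorem measurable_euclProj (hc : IsClosed K) (hK : Convex ℝ K) (hne : K.Nonempty) :
    Measurable (euclProj K) := by
  refine (LipschitzWith.of_dist_le_mul (K := 1) fun v v' => ?_).continuous.measurable
  simpa [dist_eq_norm] using norm_euclProj_sub_le hc hK hne v v'

theorem euclProj_eq_of_mem (hc : IsClosed K) (hK : Convex ℝ K) {v : EuclideanSpace ℝ (Fin d)}
    (hv : v ∈ K) : euclProj K v = v := by
  have h := (euclProj_spec hc hK ⟨v, hv⟩ v).2 v hv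
  rw [real_inner_self_eq_norm_sq] at h
  have : ‖v - euclProj K v‖ = 0 := by nlinarith [norm_nonneg (v - euclProj K v)]
  exact (sub_eq_zero.1 (norm_eq_zero.1 this)).symm

/-- The reason why gradient components normal to the affine span of `K` do not influence the
algorithm. -/
theorem euclProj_add_eq (hc : IsClosed K) (hK : Convex ℝ K) (hne : K.Nonempty)
    (v u : EuclideanSpace ℝ (Fin d)) (hu : ∀ w ∈ K, ∀ w' ∈ K, ⟪u, w - w'⟫ = 0) :
    euclProj K (v + u) = euclProj K v := by
  obtain ⟨h1, h2⟩ := euclProj_spec hc hK hne v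
  obtain ⟨h1', h2'⟩ := euclProj_spec hc hK hne (v + u)
  set p := euclProj K v
  set p' := euclProj K (v + u)
  have h3 := h2 p' h1'
  have h4 := h2' p h1
  have h5 := hu p h1 p' h1'
  have h6 : ‖p' - p‖ ^ 2 ≤ 0 := by
    rw [← real_inner_self_eq_norm_sq]
    simp only [inner_sub_left, inner_sub_right, inner_add_left] at *
    linarith
  have : ‖p' - p‖ = 0 := by nlinarith [norm_nonneg (p' - p)]
  exact sub_eq_zero.1 (norm_eq_zero.1 this)

end Projection

/-! ### Relative interior and first-order inequalities -/

theorem Convex.exists_add_mem_of_mem_vectorSpan {E : Type*} [NormedAddCommGroup E]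
    [NormedSpace ℝ E] [FiniteDimensional ℝ E] {K : Set E} (hK : Convex ℝ K) (hne : K.Nonempty) :
    ∃ c ∈ K, ∃ r > 0, ∀ v ∈ vectorSpan ℝ K, ‖v‖ ≤ r → c + v ∈ K := by
  obtain ⟨c, hc⟩ := hne.intrinsicInterior hK
  obtain ⟨y, hy, rfl⟩ := mem_intrinsicInterior.1 hc
  obtain ⟨r, hr, hball⟩ := Metric.mem_nhds_iff.1 (mem_interior_iff_mem_nhds.1 hy)
  refine ⟨y, (interior_subset hy : y ∈ _), r / 2, by positivity, fun v hv hvr => ?_⟩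
  have hmem : (y : E) + v ∈ affineSpan ℝ K := by
    rw [add_comm]
    exact AffineSubspace.vadd_mem_of_mem_direction (by rwa [direction_affineSpan]) y.2
  refine hball (a := ⟨y + v, hmem⟩) ?_
  rw [Metric.mem_ball, Subtype.dist_eq, dist_eq_norm, add_sub_cancel_left]
  linarith

section Smooth

variable {E : Type*} [NormedAddCommGroup E] [InnerProductSpace ℝ E] [CompleteSpace E]
  {K : Set E} {F : E → ℝ} {g : E → E} {β : ℝ}

theorem HasGradientWithinAt.hasDerivWithinAt_segment (hK : Convex ℝ K) {x y z : E} (hx : x ∈ K)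
    (hy : y ∈ K) {t : ℝ} (h : HasGradientWithinAt F z K (x + t • (y - x))) :
    HasDerivWithinAt (fun s : ℝ => F (x + s • (y - x))) ⟪z, y - x⟫ (Set.Icc 0 1) t := by
  have h1 : HasDerivWithinAt (fun s : ℝ => x + s • (y - x)) (y - x) (Set.Icc 0 1) t := by
    simpa using (((hasDerivAt_id t).smul_const (y - x)).const_add x).hasDerivWithinAt
  have h2 := h.hasFDerivWithinAt.comp_hasDerivWithinAt t h1
    fun s hs => hK.add_smul_sub_mem hx hy hs
  rw [← InnerProductSpace.toDual_apply_apply]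
  exact h2

theorem ConvexOn.add_inner_gradient_le (hF : ConvexOn ℝ K F) {x y z : E} (hx : x ∈ K)
    (hy : y ∈ K) (h : HasGradientWithinAt F z K x) : F x + ⟪z, y - x⟫ ≤ F y := by
  have h1 := HasGradientWithinAt.hasDerivWithinAt_segment hF.1 hx hy (t := 0) (by simpa using h)
  have h2 : ConvexOn ℝ (Set.Icc (0 : ℝ) 1) fun s : ℝ => F (x + s • (y - x)) := by
    refine ⟨convex_Icc _ _, fun s hs t ht a b ha hb hab => ?_⟩
    have h3 := hF.2 (hF.1.add_smul_sub_mem hx hy hs) (hF.1.add_smul_sub_mem hx hy ht) ha hb hab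
    convert h3 using 2
    have : x = a • x + b • x := by rw [← add_smul, hab, one_smul]
    nth_rewrite 1 [this]
    module
  have h3 := h2.le_slope_of_hasDerivWithinAt (x := 0) (y := 1) (by simp) (by simp) one_pos h1
  simp [slope_def_field] at h3
  linarith

/-- The descent lemma by monotonicity: along the segment, `F` minus its quadratic upper model has
nonpositive derivative. -/
theorem le_add_inner_gradient_add_sq (hK : Convex ℝ K)
    (hg : ∀ w ∈ K, HasGradientWithinAt F (g w) K w)
    (hβ : ∀ w ∈ K, ∀ w' ∈ K, ‖g w - g w'‖ ≤ β * ‖w - w'‖) {x y : E} (hx : x ∈ K) (hy : y ∈ K) :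
    F y ≤ F x + ⟪g x, y - x⟫ + β / 2 * ‖y - x‖ ^ 2 := by
  have hmem := fun (s : ℝ) (hs : s ∈ Set.Icc (0 : ℝ) 1) => hK.add_smul_sub_mem hx hy hs
  have h1 : ∀ s ∈ Set.Icc (0 : ℝ) 1, HasDerivWithinAt
      (fun s : ℝ => F (x + s • (y - x)) - s * ⟪g x, y - x⟫ - s ^ 2 * (β / 2 * ‖y - x‖ ^ 2))
      (⟪g (x + s • (y - x)), y - x⟫ - ⟪g x, y - x⟫ - 2 * s * (β / 2 * ‖y - x‖ ^ 2))
      (Set.Icc 0 1) s := fun s hs => by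
    have h2 := (hg _ (hmem s hs)).hasDerivWithinAt_segment hK hx hy
    refine (h2.sub ?_).sub ?_
    · simpa using ((hasDerivAt_id s).mul_const ⟪g x, y - x⟫).hasDerivWithinAt
    · simpa using ((hasDerivAt_pow 2 s).mul_const (β / 2 * ‖y - x‖ ^ 2)).hasDerivWithinAt
  have h2 : AntitoneOn
      (fun s : ℝ => F (x + s • (y - x)) - s * ⟪g x, y - x⟫ - s ^ 2 * (β / 2 * ‖y - x‖ ^ 2))
      (Set.Icc 0 1) := by
    refine antitoneOn_of_hasDerivWithinAt_nonpos (convex_Icc 0 1)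
      (fun s hs => (h1 s hs).continuousWithinAt)
      (fun s hs => (h1 s (interior_subset hs)).mono interior_subset) fun s hs => ?_
    have hs := interior_subset hs
    have h3 := real_inner_le_norm (g (x + s • (y - x)) - g x) (y - x)
    have h4 := hβ _ (hmem s hs) x hx
    rw [add_sub_cancel_left, norm_smul, Real.norm_of_nonneg hs.1] at h4
    rw [inner_sub_left] at h3
    nlinarith [norm_nonneg (y - x)]
  have h3 := h2 (Set.left_mem_Icc.2 zero_le_one) (Set.right_mem_Icc.2 zero_le_one) zero_le_one
  simp at h3
  linarith

end Smooth

/-- The point is the convex combination of `w` and `c + s⁻¹ v` with weights `1 - s` and `s`: moving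
towards `c` by the fraction `s` creates room `s * r`. -/
theorem Convex.add_smul_sub_add_mem {E : Type*} [NormedAddCommGroup E] [NormedSpace ℝ E]
    {K : Set E} {V : Submodule ℝ E} (hK : Convex ℝ K) {c : E} {r : ℝ}
    (hc : ∀ v ∈ V, ‖v‖ ≤ r → c + v ∈ K) {s : ℝ} (hs : 0 < s) (hs1 : s ≤ 1) {w v : E} (hw : w ∈ K)
    (hv : v ∈ V) (hvr : ‖v‖ ≤ s * r) : w + s • (c - w) + v ∈ K := by
  have h1 : c + s⁻¹ • v ∈ K := hc _ (V.smul_mem _ hv) (by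
    rw [norm_smul, norm_inv, Real.norm_of_nonneg hs.le, inv_mul_le_iff₀ hs]
    exact hvr)
  have h2 := hK.add_smul_sub_mem hw h1 ⟨hs.le, hs1⟩
  convert h2 using 1
  rw [add_sub_right_comm, smul_add, smul_smul, mul_inv_cancel₀ hs.ne', one_smul, add_assoc]

theorem le_of_forall_le_add_mul {a b M : ℝ} (h : ∀ s : ℝ, 0 < s → s ≤ 1 → a ≤ b + s * M) :
    a ≤ b := by
  have h1 : Filter.Tendsto (fun s : ℝ => b + s * M) (nhdsWithin 0 (Set.Ioi 0)) (nhds b) := by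
    have : Filter.Tendsto (fun s : ℝ => b + s * M) (nhds 0) (nhds (b + 0 * M)) :=
      Continuous.tendsto (by fun_prop) 0
    simpa using this.mono_left nhdsWithin_le_nhds
  refine ge_of_tendsto h1 ?_
  filter_upwards [Ioc_mem_nhdsGT (zero_lt_one' ℝ)] with s hs using h s hs.1 hs.2

/-! ### Nonexpansive gradient steps on a convex set -/

section Cocoercive

variable {E : Type*} [NormedAddCommGroup E] [InnerProductSpace ℝ E] [FiniteDimensional ℝ E]
  {K : Set E} {F : E → ℝ} {g : E → E} {β : ℝ}

theorem Submodule.inner_starProjection_of_mem (V : Submodule ℝ E) (u : E) {v : E} (hv : v ∈ V) :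
    ⟪V.starProjection u, v⟫ = ⟪u, v⟫ := by
  rw [V.inner_starProjection_left_eq_right, V.starProjection_eq_self_iff.2 hv]

/-- Half of the Baillon–Haddad argument. At the trial point `y - β⁻¹ D`, convexity bounds `F` from
below by the tangent at `x` and the descent lemma bounds it from above from `y`. The trial point has
to stay in `K`. -/
theorem add_inner_add_norm_starProjection_sq_le (hβ0 : 0 < β) (hF : ConvexOn ℝ K F)
    (hg : ∀ w ∈ K, HasGradientWithinAt F (g w) K w)
    (hβ : ∀ w ∈ K, ∀ w' ∈ K, ‖g w - g w'‖ ≤ β * ‖w - w'‖) (V : Submodule ℝ E) {x y : E}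
    (hx : x ∈ K) (hy : y ∈ K) (hp : y - β⁻¹ • V.starProjection (g y - g x) ∈ K) :
    F x + ⟪g x, y - x⟫ + (2 * β)⁻¹ * ‖V.starProjection (g y - g x)‖ ^ 2 ≤ F y := by
  set D := V.starProjection (g y - g x) with hD
  have h1 := hF.add_inner_gradient_le hx hp (hg x hx)
  have h2 := le_add_inner_gradient_add_sq hF.1 hg hβ hy hp
  have h3 : ⟪g y - g x, D⟫ = ‖D‖ ^ 2 := by
    rw [← V.inner_starProjection_of_mem _ (V.starProjection_apply_mem _), ← hD,
      real_inner_self_eq_norm_sq]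
  rw [inner_sub_left] at h3
  have h4 : y - β⁻¹ • D - x = (y - x) - β⁻¹ • D := by abel
  have h5 : y - β⁻¹ • D - y = -(β⁻¹ • D) := by abel
  rw [h4, inner_sub_right, inner_smul_right] at h1
  rw [h5, inner_neg_right, inner_smul_right, norm_neg, norm_smul, mul_pow, norm_inv,
    Real.norm_of_nonneg hβ0.le] at h2
  have h6 : β / 2 * (β⁻¹ ^ 2 * ‖D‖ ^ 2) = (2 * β)⁻¹ * ‖D‖ ^ 2 := by field_simp
  have h7 : (2 * β)⁻¹ * ‖D‖ ^ 2 = β⁻¹ * ‖D‖ ^ 2 / 2 := by field_simp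
  have h8 : β⁻¹ * ⟪g y, D⟫ - β⁻¹ * ⟪g x, D⟫ = β⁻¹ * ‖D‖ ^ 2 := by rw [← mul_sub, h3]
  rw [h6] at h2
  linarith

/-- Smoothness keeps both trial points within `‖x - y‖ ≤ δ` of `y` and `x`. Adding the two
inequalities gives cocoercivity `‖D‖²/β ≤ ⟪D, x - y⟫`, and `η ≤ 2/β` is what the expanded square
needs. -/
theorem norm_gradient_step_sub_le_of_near (hβ0 : 0 < β) (hF : ConvexOn ℝ K F)
    (hg : ∀ w ∈ K, HasGradientWithinAt F (g w) K w)
    (hβ : ∀ w ∈ K, ∀ w' ∈ K, ‖g w - g w'‖ ≤ β * ‖w - w'‖) {V : Submodule ℝ E}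
    {η : ℝ} (hη : 0 < η) (hη2 : η ≤ 2 / β) {δ : ℝ} {x y : E} (hV : x - y ∈ V)
    (hx : ∀ v ∈ V, ‖v‖ ≤ δ → x + v ∈ K) (hy : ∀ v ∈ V, ‖v‖ ≤ δ → y + v ∈ K)
    (hxy : ‖x - y‖ ≤ δ) :
    ‖(x - η • V.starProjection (g x)) - (y - η • V.starProjection (g y))‖ ≤ ‖x - y‖ := by
  have hδ : 0 ≤ δ := (norm_nonneg _).trans hxy
  have hxK : x ∈ K := by simpa using hx 0 V.zero_mem (by simpa)
  have hyK : y ∈ K := by simpa using hy 0 V.zero_mem (by simpa)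
  set D := V.starProjection (g x - g y) with hD
  have hD' : V.starProjection (g y - g x) = -D := by rw [hD, ← map_neg, neg_sub]
  have hDV : D ∈ V := V.starProjection_apply_mem _
  have hDn : ‖D‖ ≤ β * ‖x - y‖ := (V.norm_starProjection_apply_le _).trans (hβ x hxK y hyK)
  have hn : ‖β⁻¹ • D‖ ≤ δ := by
    rw [norm_smul, norm_inv, Real.norm_of_nonneg hβ0.le]
    refine le_trans ?_ hxy
    rw [inv_mul_le_iff₀ hβ0]
    exact hDn
  have h1 := add_inner_add_norm_starProjection_sq_le hβ0 hF hg hβ V hxK hyK (by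
    rw [hD', smul_neg, sub_neg_eq_add]
    exact hy _ (V.smul_mem _ hDV) hn)
  have h2 := add_inner_add_norm_starProjection_sq_le hβ0 hF hg hβ V hyK hxK (by
    rw [← hD, sub_eq_add_neg]
    exact hx _ (V.neg_mem (V.smul_mem _ hDV)) (by rwa [norm_neg]))
  rw [hD', norm_neg, ← neg_sub x y, inner_neg_right] at h1
  rw [← hD] at h2
  have h3 : ⟪D, x - y⟫ = ⟪g x, x - y⟫ - ⟪g y, x - y⟫ := by
    rw [V.inner_starProjection_of_mem _ hV, inner_sub_left]
  have h7 : (2 * β)⁻¹ * ‖D‖ ^ 2 = ‖D‖ ^ 2 / β / 2 := by field_simp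
  have h4 : ‖D‖ ^ 2 / β ≤ ⟪D, x - y⟫ := by linarith
  have h5 : (x - η • V.starProjection (g x)) - (y - η • V.starProjection (g y))
      = (x - y) - η • D := by
    rw [hD, map_sub, smul_sub]; abel
  rw [h5]
  refine le_of_sq_le_sq ?_ (norm_nonneg _)
  rw [norm_sub_sq_real, inner_smul_right, real_inner_comm, norm_smul, mul_pow,
    Real.norm_of_nonneg hη.le]
  have h6 : η * ‖D‖ ^ 2 ≤ 2 * (‖D‖ ^ 2 / β) := by
    calc η * ‖D‖ ^ 2 ≤ 2 / β * ‖D‖ ^ 2 := by gcongr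
      _ = _ := by ring
  nlinarith

theorem norm_gradient_step_sub_le_of_segment (hβ0 : 0 < β) (hF : ConvexOn ℝ K F)
    (hg : ∀ w ∈ K, HasGradientWithinAt F (g w) K w)
    (hβ : ∀ w ∈ K, ∀ w' ∈ K, ‖g w - g w'‖ ≤ β * ‖w - w'‖) {V : Submodule ℝ E}
    {η : ℝ} (hη : 0 < η) (hη2 : η ≤ 2 / β) {δ : ℝ} (hδ : 0 < δ) {x y : E} (hV : y - x ∈ V)
    (h : ∀ t ∈ Set.Icc (0 : ℝ) 1, ∀ v ∈ V, ‖v‖ ≤ δ → x + t • (y - x) + v ∈ K) :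
    ‖(x - η • V.starProjection (g x)) - (y - η • V.starProjection (g y))‖ ≤ ‖x - y‖ := by
  -- Cut the segment into `N` pieces shorter than `δ`; the local estimates sum to the full length.
  obtain ⟨N, hN⟩ := exists_nat_gt (‖y - x‖ / δ)
  have hN0 : (0 : ℝ) < N := lt_of_le_of_lt (by positivity) hN
  set u : ℕ → E := fun k => x + ((k : ℝ) / N) • (y - x) with hu
  set ψ : E → E := fun w => w - η • V.starProjection (g w) with hψ
  have hdiff : ∀ k, u k - u (k + 1) = -((N : ℝ)⁻¹ • (y - x)) := fun k => by
    simp only [hu]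
    push_cast
    rw [add_div]
    module
  have hnorm : ∀ k, ‖u k - u (k + 1)‖ = ‖y - x‖ / N := fun k => by
    rw [hdiff, norm_neg, norm_smul, norm_inv, Real.norm_of_nonneg hN0.le]
    ring
  have hstep : ∀ k < N, dist (ψ (u k)) (ψ (u (k + 1))) ≤ ‖y - x‖ / N := fun k hk => by
    have hk1 : ((k : ℝ) / N) ∈ Set.Icc (0 : ℝ) 1 :=
      ⟨by positivity, (div_le_one hN0).2 (by exact_mod_cast hk.le)⟩
    have hk2 : (((k + 1 : ℕ) : ℝ) / N) ∈ Set.Icc (0 : ℝ) 1 :=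
      ⟨by positivity, (div_le_one hN0).2 (by exact_mod_cast hk)⟩
    rw [dist_eq_norm, ← hnorm k]
    refine norm_gradient_step_sub_le_of_near hβ0 hF hg hβ hη hη2 (δ := δ) ?_ (h _ hk1)
      (h _ hk2) ?_
    · rw [hdiff]
      exact V.neg_mem (V.smul_mem _ hV)
    · rw [hnorm, div_le_iff₀ hN0]
      rw [div_lt_iff₀ hδ] at hN
      linarith
  have hsum := dist_le_range_sum_of_dist_le (f := fun k => ψ (u k)) N fun {k} hk => hstep k hk
  have h0 : u 0 = x := by simp [hu]
  have h1 : u N = y := by simp [hu, div_self hN0.ne']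
  simp only [h0, h1, Finset.sum_const, Finset.card_range, nsmul_eq_mul] at hsum
  rw [mul_div_cancel₀ _ hN0.ne', dist_eq_norm] at hsum
  rwa [norm_sub_rev x y]

/-- Pulling both endpoints towards a relative interior point `c` by the fraction `s` gives uniform
room along the segment. The step map is `(1 + ηβ)`-Lipschitz, so the error is `O(s)`. -/
theorem norm_gradient_step_sub_le (hβ0 : 0 < β) (hF : ConvexOn ℝ K F)
    (hg : ∀ w ∈ K, HasGradientWithinAt F (g w) K w)
    (hβ : ∀ w ∈ K, ∀ w' ∈ K, ‖g w - g w'‖ ≤ β * ‖w - w'‖) {η : ℝ} (hη : 0 < η) (hη2 : η ≤ 2 / β)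
    {x y : E} (hx : x ∈ K) (hy : y ∈ K) :
    ‖(x - η • (vectorSpan ℝ K).starProjection (g x))
      - (y - η • (vectorSpan ℝ K).starProjection (g y))‖ ≤ ‖x - y‖ := by
  set V := vectorSpan ℝ K with hV
  obtain ⟨c, hcK, r, hr, hc⟩ := hF.1.exists_add_mem_of_mem_vectorSpan ⟨x, hx⟩
  set ψ : E → E := fun w => w - η • V.starProjection (g w) with hψ
  have hψL : ∀ w ∈ K, ∀ w' ∈ K, ‖ψ w - ψ w'‖ ≤ (1 + η * β) * ‖w - w'‖ := fun w hw w' hw' => by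
    have h1 : ψ w - ψ w' = (w - w') - η • V.starProjection (g w - g w') := by
      simp only [hψ, map_sub, smul_sub]; abel
    rw [h1]
    refine (norm_sub_le _ _).trans ?_
    rw [norm_smul, Real.norm_of_nonneg hη.le, add_mul, one_mul, mul_assoc]
    gcongr
    exact (V.norm_starProjection_apply_le _).trans (hβ w hw w' hw')
  refine le_of_forall_le_add_mul (M := (1 + η * β) * ‖x - c‖ + (1 + η * β) * ‖y - c‖)
    fun s hs hs1 => ?_
  have hmem : ∀ w ∈ K, w + s • (c - w) ∈ K := fun w hw =>
    hF.1.add_smul_sub_mem hw hcK ⟨hs.le, hs1⟩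
  have hdist : ∀ w ∈ K, ‖ψ w - ψ (w + s • (c - w))‖ ≤ (1 + η * β) * (s * ‖w - c‖) :=
    fun w hw => by
      refine (hψL w hw _ (hmem w hw)).trans_eq ?_
      rw [sub_add_cancel_left, norm_neg, norm_smul, Real.norm_of_nonneg hs.le, norm_sub_rev]
  have hdiff : (y + s • (c - y)) - (x + s • (c - x)) = (1 - s) • (y - x) := by module
  have hmain : ‖ψ (x + s • (c - x)) - ψ (y + s • (c - y))‖ ≤ ‖x - y‖ := by
    have h1 := norm_gradient_step_sub_le_of_segment hβ0 hF hg hβ hη hη2 (V := V)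
      (δ := s * r) (by positivity) (x := x + s • (c - x)) (y := y + s • (c - y))
      (by rw [hdiff]; exact V.smul_mem _ (vsub_mem_vectorSpan ℝ hy hx)) (fun t ht v hv hvr => by
        have h2 := hF.1.add_smul_sub_add_mem hc hs hs1 (hF.1.add_smul_sub_mem hx hy ht) hv hvr
        convert h2 using 2
        module)
    refine h1.trans ?_
    rw [norm_sub_rev, hdiff, norm_smul, Real.norm_of_nonneg (by linarith), norm_sub_rev y x]
    exact mul_le_of_le_one_left (norm_nonneg _) (by linarith)
  have h1 : ψ x - ψ y = (ψ x - ψ (x + s • (c - x)))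
      + (ψ (x + s • (c - x)) - ψ (y + s • (c - y))) - (ψ y - ψ (y + s • (c - y))) := by abel
  change ‖ψ x - ψ y‖ ≤ _
  rw [h1]
  have h2 := norm_sub_le ((ψ x - ψ (x + s • (c - x)))
      + (ψ (x + s • (c - x)) - ψ (y + s • (c - y)))) (ψ y - ψ (y + s • (c - y)))
  have h3 := norm_add_le (ψ x - ψ (x + s • (c - x))) (ψ (x + s • (c - x)) - ψ (y + s • (c - y)))
  have h4 := hdist x hx
  have h5 := hdist y hy
  linarith

/-- Near a relative interior point one can move along the tangential gradient itself; convexity and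
the Lipschitz bound then limit its length. Smoothness carries this to all of `K` as `s → 0`. -/
theorem norm_starProjection_gradient_le (hF : ConvexOn ℝ K F)
    (hg : ∀ w ∈ K, HasGradientWithinAt F (g w) K w)
    (hβ : ∀ w ∈ K, ∀ w' ∈ K, ‖g w - g w'‖ ≤ β * ‖w - w'‖) {G : ℝ} (hG0 : 0 ≤ G)
    (hG : ∀ w ∈ K, ∀ w' ∈ K, |F w - F w'| ≤ G * ‖w - w'‖) {x : E} (hx : x ∈ K) :
    ‖(vectorSpan ℝ K).starProjection (g x)‖ ≤ G := by
  set V := vectorSpan ℝ K with hV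
  obtain ⟨c, hcK, r, hr, hc⟩ := hF.1.exists_add_mem_of_mem_vectorSpan ⟨x, hx⟩
  refine le_of_forall_le_add_mul (M := β * ‖x - c‖) fun s hs hs1 => ?_
  set w := x + s • (c - x) with hw
  have hwK : w ∈ K := hF.1.add_smul_sub_mem hx hcK ⟨hs.le, hs1⟩
  set p := V.starProjection (g w) with hp
  have hpV : p ∈ V := V.starProjection_apply_mem _
  have h1 : ‖p‖ ≤ G := by
    rcases eq_or_ne p 0 with h0 | h0
    · simpa [h0]
    have hp0 : 0 < ‖p‖ := norm_pos_iff.2 h0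
    set l := s * r / ‖p‖ with hl
    have hl0 : 0 < l := by positivity
    have hln : ‖l • p‖ = s * r := by
      rw [norm_smul, Real.norm_of_nonneg hl0.le, hl, div_mul_cancel₀ _ hp0.ne']
    have h2 : w + l • p ∈ K := hF.1.add_smul_sub_add_mem hc hs hs1 hx (V.smul_mem _ hpV) hln.le
    have h3 := hF.add_inner_gradient_le hwK h2 (hg w hwK)
    have h4 := (le_abs_self _).trans (hG _ h2 _ hwK)
    rw [add_sub_cancel_left, inner_smul_right, ← V.inner_starProjection_of_mem _ hpV, ← hp,
      real_inner_self_eq_norm_sq] at h3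
    rw [add_sub_cancel_left, norm_smul, Real.norm_of_nonneg hl0.le] at h4
    have h5 : l * ‖p‖ * ‖p‖ ≤ l * ‖p‖ * G := by nlinarith
    exact le_of_mul_le_mul_left h5 (by positivity)
  have h2 : ‖V.starProjection (g x) - p‖ ≤ s * (β * ‖x - c‖) := by
    rw [hp, ← map_sub]
    refine (V.norm_starProjection_apply_le _).trans ((hβ x hx w hwK).trans_eq ?_)
    rw [hw, sub_add_cancel_left, norm_neg, norm_smul, Real.norm_of_nonneg hs.le, norm_sub_rev]
    ring
  have h3 := norm_le_norm_add_norm_sub' (V.starProjection (g x)) p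
  linarith

end Cocoercive

/-! ### Privacy amplification by iteration -/

section NoisySGD

variable {𝒳 : Type*} {d : ℕ} {K : Set (EuclideanSpace ℝ (Fin d))}

/-- The Gaussian law `N(0, σ² I_d)`. -/
noncomputable abbrev isotropicGaussian (d : ℕ) (σ : ℝ) : Measure (EuclideanSpace ℝ (Fin d)) :=
  multivariateGaussian 0 (σ ^ 2 • (1 : Matrix (Fin d) (Fin d) ℝ))

theorem pnsgdRun_mem (hc : IsClosed K) (hK : Convex ℝ K)
    (g : EuclideanSpace ℝ (Fin d) → 𝒳 → EuclideanSpace ℝ (Fin d)) (η : ℝ)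
    {w₀ : EuclideanSpace ℝ (Fin d)} (hw₀ : w₀ ∈ K) (n : ℕ) (S : Fin n → 𝒳)
    (z : Fin n → EuclideanSpace ℝ (Fin d)) : pnsgdRun K g η w₀ n S z ∈ K := by
  cases n with
  | zero => exact hw₀
  | succ n => exact euclProj_mem hc hK ⟨w₀, hw₀⟩ _

theorem pnsgdRun_congr (hc : IsClosed K) (hK : Convex ℝ K) {X : Set 𝒳}
    {g g' : EuclideanSpace ℝ (Fin d) → 𝒳 → EuclideanSpace ℝ (Fin d)} {η : ℝ}
    (h : ∀ w ∈ K, ∀ x ∈ X, ∀ z,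
      euclProj K (w - η • (g w x + z)) = euclProj K (w - η • (g' w x + z)))
    {w₀ : EuclideanSpace ℝ (Fin d)} (hw₀ : w₀ ∈ K) (n : ℕ) (S : Fin n → 𝒳) (hS : ∀ i, S i ∈ X)
    (z : Fin n → EuclideanSpace ℝ (Fin d)) :
    pnsgdRun K g η w₀ n S z = pnsgdRun K g' η w₀ n S z := by
  induction n with
  | zero => rfl
  | succ n ih =>
    simp only [pnsgdRun]
    rw [ih (Fin.init S) (fun i => hS i.castSucc)]
    exact h _ (pnsgdRun_mem hc hK g' η hw₀ n _ _) _ (hS _) _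

theorem measurable_pnsgdRun (hc : IsClosed K) (hK : Convex ℝ K) {X : Set 𝒳}
    {g : EuclideanSpace ℝ (Fin d) → 𝒳 → EuclideanSpace ℝ (Fin d)}
    (hg : ∀ x ∈ X, Measurable fun w => g w x) (η : ℝ)
    {w₀ : EuclideanSpace ℝ (Fin d)} (hw₀ : w₀ ∈ K) (n : ℕ) (S : Fin n → 𝒳) (hS : ∀ i, S i ∈ X) :
    Measurable (pnsgdRun K g η w₀ n S) := by
  induction n with
  | zero => exact measurable_const
  | succ n ih =>
    have h1 : Measurable fun z : Fin (n + 1) → EuclideanSpace ℝ (Fin d) =>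
        pnsgdRun K g η w₀ n (Fin.init S) (Fin.init z) :=
      (ih (Fin.init S) fun i => hS i.castSucc).comp
        (measurable_pi_lambda _ fun i => measurable_pi_apply _)
    exact (measurable_euclProj hc hK ⟨w₀, hw₀⟩).comp
      (h1.sub ((((hg _ (hS _)).comp h1).add (measurable_pi_apply _)).const_smul η))

theorem lintegral_pi_last_init {E : Type*} [MeasurableSpace E] (γ : Measure E) [SigmaFinite γ]
    {n : ℕ} {f : E × (Fin n → E) → ℝ≥0∞} (hf : Measurable f) :
    ∫⁻ z, f (z (Fin.last n), Fin.init z) ∂(Measure.pi fun _ : Fin (n + 1) => γ)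
      = ∫⁻ zs, ∫⁻ z, f (z, zs) ∂γ ∂(Measure.pi fun _ : Fin n => γ) := by
  have h1 := (measurePreserving_piFinSuccAbove
    (fun _ : Fin (n + 1) => γ) (Fin.last n)).lintegral_comp hf
  rw [lintegral_prod_symm _ hf.aemeasurable] at h1
  refine Eq.trans (lintegral_congr fun z => ?_) h1
  congr 1
  exact Prod.ext rfl (Fin.removeNth_last z).symm

/-- The Markov property: integrating out the last noise vector turns the test function into one of
the previous iterate. -/
theorem lintegral_map_pnsgdRun_succ (hc : IsClosed K) (hK : Convex ℝ K) {X : Set 𝒳}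
    {g : EuclideanSpace ℝ (Fin d) → 𝒳 → EuclideanSpace ℝ (Fin d)}
    (hg : ∀ x ∈ X, Measurable fun w => g w x) (η : ℝ)
    {w₀ : EuclideanSpace ℝ (Fin d)} (hw₀ : w₀ ∈ K) (γ : Measure (EuclideanSpace ℝ (Fin d)))
    [IsProbabilityMeasure γ] {n : ℕ} (S : Fin (n + 1) → 𝒳)
    (hS : ∀ i, S i ∈ X) {φ : EuclideanSpace ℝ (Fin d) → ℝ≥0∞} (hφ : Measurable φ) :
    ∫⁻ w, φ w ∂(Measure.pi fun _ : Fin (n + 1) => γ).map (pnsgdRun K g η w₀ (n + 1) S)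
      = ∫⁻ w, (∫⁻ z, φ (euclProj K (w - η • g w (S (Fin.last n)) - η • z)) ∂γ)
          ∂(Measure.pi fun _ : Fin n => γ).map (pnsgdRun K g η w₀ n (Fin.init S)) := by
  have hP := measurable_euclProj hc hK ⟨w₀, hw₀⟩
  have hR := measurable_pnsgdRun hc hK hg η hw₀ n (Fin.init S) fun i => hS i.castSucc
  have hgS := hg _ (hS (Fin.last n))
  have hm : Measurable fun p : EuclideanSpace ℝ (Fin d) × EuclideanSpace ℝ (Fin d) =>
      φ (euclProj K (p.1 - η • g p.1 (S (Fin.last n)) - η • p.2)) :=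
    hφ.comp (hP.comp ((measurable_fst.sub ((hgS.comp measurable_fst).const_smul η)).sub
      (measurable_snd.const_smul η)))
  have hmI : Measurable fun w =>
      ∫⁻ z, φ (euclProj K (w - η • g w (S (Fin.last n)) - η • z)) ∂γ := hm.lintegral_prod_right'
  have hRs : Measurable fun p : EuclideanSpace ℝ (Fin d) × (Fin n → EuclideanSpace ℝ (Fin d)) =>
      (pnsgdRun K g η w₀ n (Fin.init S) p.2, p.1) :=
    (hR.comp measurable_snd).prodMk measurable_fst
  have hfm := hm.comp hRs
  rw [lintegral_map hφ (measurable_pnsgdRun hc hK hg η hw₀ _ S hS), lintegral_map hmI hR]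
  refine Eq.trans (lintegral_congr fun z => ?_) (lintegral_pi_last_init γ hfm)
  simp only [pnsgdRun, smul_add, sub_add_eq_sub_sub, Function.comp_apply]

theorem lintegral_pnsgd_succ (hc : IsClosed K) (hK : Convex ℝ K) {X : Set 𝒳}
    {g : EuclideanSpace ℝ (Fin d) → 𝒳 → EuclideanSpace ℝ (Fin d)}
    (hg : ∀ x ∈ X, Measurable fun w => g w x) (η σ : ℝ)
    {w₀ : EuclideanSpace ℝ (Fin d)} (hw₀ : w₀ ∈ K) {n : ℕ} (S : Fin (n + 1) → 𝒳)
    (hS : ∀ i, S i ∈ X) {φ : EuclideanSpace ℝ (Fin d) → ℝ≥0∞} (hφ : Measurable φ) :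
    ∫⁻ w, φ w ∂pnsgd K g η σ w₀ S
      = ∫⁻ w, (∫⁻ z, φ (euclProj K (w - η • g w (S (Fin.last n)) - η • z))
          ∂isotropicGaussian d σ) ∂pnsgd K g η σ w₀ (Fin.init S) :=
  lintegral_map_pnsgdRun_succ hc hK hg η hw₀ (isotropicGaussian d σ) S hS hφ

theorem isProbabilityMeasure_pnsgd (hc : IsClosed K) (hK : Convex ℝ K) {X : Set 𝒳}
    {g : EuclideanSpace ℝ (Fin d) → 𝒳 → EuclideanSpace ℝ (Fin d)}
    (hg : ∀ x ∈ X, Measurable fun w => g w x) (η σ : ℝ)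
    {w₀ : EuclideanSpace ℝ (Fin d)} (hw₀ : w₀ ∈ K) {n : ℕ} (S : Fin n → 𝒳)
    (hS : ∀ i, S i ∈ X) : IsProbabilityMeasure (pnsgd K g η σ w₀ S) :=
  Measure.isProbabilityMeasure_map (measurable_pnsgdRun hc hK hg η hw₀ n S hS).aemeasurable

theorem ae_mem_pnsgd (hc : IsClosed K) (hK : Convex ℝ K) {X : Set 𝒳}
    {g : EuclideanSpace ℝ (Fin d) → 𝒳 → EuclideanSpace ℝ (Fin d)}
    (hg : ∀ x ∈ X, Measurable fun w => g w x) (η σ : ℝ)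
    {w₀ : EuclideanSpace ℝ (Fin d)} (hw₀ : w₀ ∈ K) {n : ℕ} (S : Fin n → 𝒳)
    (hS : ∀ i, S i ∈ X) : ∀ᵐ w ∂pnsgd K g η σ w₀ S, w ∈ K := by
  rw [pnsgd, ae_map_iff (p := (· ∈ K)) (measurable_pnsgdRun hc hK hg η hw₀ n S hS).aemeasurable hc.measurableSet]
  exact ae_of_all _ fun z => pnsgdRun_mem hc hK g η hw₀ n S z

theorem exists_norm_le_norm_sub_le {E : Type*} [NormedAddCommGroup E] [NormedSpace ℝ E] {v : E}
    {a r : ℝ} (ha : 0 ≤ a) (hr : 0 ≤ r) (hv : ‖v‖ ≤ r + a) : ∃ b : E, ‖b‖ ≤ a ∧ ‖v - b‖ ≤ r := by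
  rcases (add_nonneg hr ha).eq_or_lt with h0 | h0
  · refine ⟨0, by simpa, ?_⟩
    rw [sub_zero]
    linarith
  · refine ⟨(a / (r + a)) • v, ?_, ?_⟩
    · rw [norm_smul, Real.norm_of_nonneg (by positivity), div_mul_eq_mul_div, div_le_iff₀ h0]
      gcongr
    · have h1 : v - (a / (r + a)) • v = (r / (r + a)) • v := by
        have h2 : r / (r + a) = 1 - a / (r + a) := by field_simp; ring
        rw [h2, sub_smul, one_smul]
      rw [h1, norm_smul, Real.norm_of_nonneg (by positivity), div_mul_eq_mul_div, div_le_iff₀ h0]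
      gcongr

/-- One noisy projected step: domination of `φ` by `ψ` at distance at most `r` becomes domination
at distance at most `r + a` of the centers, at the price of a Gaussian shift of length `a`. -/
theorem lintegral_euclProj_le (hc : IsClosed K) (hK : Convex ℝ K) (hne : K.Nonempty) {α q : ℝ}
    (hαq : α.HolderConjugate q) {η σ a r : ℝ} (hη : 0 < η) (ha : 0 ≤ a) (hr : 0 ≤ r)
    (hσ : σ = 0 → a = 0) {φ ψ : EuclideanSpace ℝ (Fin d) → ℝ≥0∞} (hφ : Measurable φ)
    (hψ : Measurable ψ) {C : ℝ≥0∞}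
    (hdom : ∀ w ∈ K, ∀ w' ∈ K, ‖w - w'‖ ≤ r → φ w ≤ C * ψ w' ^ (1 / q))
    {u u' : EuclideanSpace ℝ (Fin d)} (hu : ‖u - u'‖ ≤ r + a) :
    ∫⁻ z, φ (euclProj K (u - η • z)) ∂isotropicGaussian d σ
      ≤ C * ENNReal.ofReal (Real.exp ((α - 1) * (a / η) ^ 2 / (2 * σ ^ 2)))
        * (∫⁻ z, ψ (euclProj K (u' - η • z)) ∂isotropicGaussian d σ) ^ (1 / q) := by
  have hq := hαq.symm.pos
  have hP := measurable_euclProj hc hK hne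
  -- The noise absorbs `b` through a shift by `-η⁻¹ b`; the remaining gap between `u - b` and `u'`
  -- is at most `r`.
  obtain ⟨b, hb, hub⟩ := exists_norm_le_norm_sub_le ha hr hu
  have hB : σ = 0 → -(η⁻¹ • b) = 0 := fun h => by
    rw [norm_le_zero_iff.1 (hb.trans_eq (hσ h)), smul_zero, neg_zero]
  have hm : Measurable fun z => φ (euclProj K (u - b - η • z)) := hφ.comp (hP.comp (by fun_prop))
  have h1 := holderDominated_multivariateGaussian_map_add hαq σ (-(η⁻¹ • b)) hB _ hm
  rw [lintegral_map hm (by fun_prop)] at h1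
  have h2 : ∀ z : EuclideanSpace ℝ (Fin d), u - b - η • (z + -(η⁻¹ • b)) = u - η • z := fun z => by
    rw [smul_add, smul_neg, smul_smul, mul_inv_cancel₀ hη.ne', one_smul]
    abel
  simp only [h2] at h1
  refine h1.trans ?_
  have h3 : Real.exp ((α - 1) * ‖-(η⁻¹ • b)‖ ^ 2 / (2 * σ ^ 2))
      ≤ Real.exp ((α - 1) * (a / η) ^ 2 / (2 * σ ^ 2)) := by
    have := hαq.lt
    have h4 : ‖-(η⁻¹ • b)‖ ≤ a / η := by
      rw [norm_neg, norm_smul, norm_inv, Real.norm_of_nonneg hη.le, inv_mul_eq_div]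
      gcongr
    have h5 : 0 ≤ α - 1 := by linarith
    gcongr
  have h4 : (∫⁻ z, φ (euclProj K (u - b - η • z)) ^ q ∂isotropicGaussian d σ) ^ (1 / q)
      ≤ C * (∫⁻ z, ψ (euclProj K (u' - η • z)) ∂isotropicGaussian d σ) ^ (1 / q) := by
    calc (∫⁻ z, φ (euclProj K (u - b - η • z)) ^ q ∂isotropicGaussian d σ) ^ (1 / q)
        ≤ (∫⁻ z, C ^ q * ψ (euclProj K (u' - η • z)) ∂isotropicGaussian d σ) ^ (1 / q) := by
          gcongr with z
          have h5 := hdom _ (euclProj_mem hc hK hne (u - b - η • z)) _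
            (euclProj_mem hc hK hne (u' - η • z)) ((norm_euclProj_sub_le hc hK hne _ _).trans (by
              rwa [sub_sub_sub_cancel_right, sub_right_comm]))
          refine (ENNReal.rpow_le_rpow h5 hq.le).trans_eq ?_
          rw [ENNReal.mul_rpow_of_nonneg _ _ hq.le, ← ENNReal.rpow_mul, one_div,
            inv_mul_cancel₀ hq.ne', ENNReal.rpow_one]
      _ = _ := by
          have hm' : Measurable fun z => ψ (euclProj K (u' - η • z)) :=
            hψ.comp (hP.comp (by fun_prop))
          rw [lintegral_const_mul _ hm',
            ENNReal.mul_rpow_of_nonneg _ _ (by positivity), ← ENNReal.rpow_mul, one_div,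
            mul_inv_cancel₀ hq.ne', ENNReal.rpow_one]
  calc _ ≤ ENNReal.ofReal (Real.exp ((α - 1) * (a / η) ^ 2 / (2 * σ ^ 2)))
        * (C * (∫⁻ z, ψ (euclProj K (u' - η • z)) ∂isotropicGaussian d σ) ^ (1 / q)) := by
        gcongr
    _ = _ := by ring

/-- Backward induction, where `j` counts the steps already peeled off. Each peeled step replaces
`φ`, `ψ` by their one-step averages, widens the radius of domination by `a` and costs one Gaussian
factor. The budget `hj` says that the radius reaches `ηΔ` at the differing input. -/
theorem lintegral_pnsgd_le (hc : IsClosed K) (hK : Convex ℝ K) {X : Set 𝒳}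
    {g : EuclideanSpace ℝ (Fin d) → 𝒳 → EuclideanSpace ℝ (Fin d)}
    (hg : ∀ x ∈ X, Measurable fun w => g w x) {η : ℝ} (hη : 0 < η)
    (hcontr : ∀ x ∈ X, ∀ w ∈ K, ∀ w' ∈ K,
      ‖(w - η • g w x) - (w' - η • g w' x)‖ ≤ ‖w - w'‖)
    {w₀ : EuclideanSpace ℝ (Fin d)} (hw₀ : w₀ ∈ K) {α q : ℝ} (hαq : α.HolderConjugate q)
    {σ a Δ : ℝ} (ha : 0 ≤ a) (hσ : σ = 0 → a = 0) {n : ℕ} (t : Fin n) (S S' : Fin n → 𝒳)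
    (hS : ∀ i, S i ∈ X) (hS' : ∀ i, S' i ∈ X) (hSS' : ∀ i, i ≠ t → S i = S' i)
    (hΔ : ∀ w ∈ K, ‖g w (S t) - g w (S' t)‖ ≤ Δ) (j : ℕ) (hj : η * Δ ≤ (j + (n - t : ℕ)) * a)
    {φ ψ : EuclideanSpace ℝ (Fin d) → ℝ≥0∞} (hφ : Measurable φ) (hψ : Measurable ψ) {C : ℝ≥0∞}
    (hdom : ∀ w ∈ K, ∀ w' ∈ K, ‖w - w'‖ ≤ j * a → φ w ≤ C * ψ w' ^ (1 / q)) :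
    ∫⁻ w, φ w ∂pnsgd K g η σ w₀ S
      ≤ C * ENNReal.ofReal (Real.exp ((α - 1) * (a / η) ^ 2 / (2 * σ ^ 2))) ^ (n - t : ℕ)
        * (∫⁻ w, ψ w ∂pnsgd K g η σ w₀ S') ^ (1 / q) := by
  have hne : K.Nonempty := ⟨w₀, hw₀⟩
  have hq := hαq.symm.pos
  have hP := measurable_euclProj hc hK hne
  induction n generalizing j φ ψ C with
  | zero => exact t.elim0
  | succ n ih =>
    rw [lintegral_pnsgd_succ hc hK hg η σ hw₀ S hS hφ,
      lintegral_pnsgd_succ hc hK hg η σ hw₀ S' hS' hψ]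
    have hmeas : ∀ x ∈ X, ∀ {χ : EuclideanSpace ℝ (Fin d) → ℝ≥0∞}, Measurable χ →
        Measurable fun w => ∫⁻ z, χ (euclProj K (w - η • g w x - η • z))
          ∂isotropicGaussian d σ := fun x hx χ hχ => by
      have h1 : Measurable fun p : EuclideanSpace ℝ (Fin d) × EuclideanSpace ℝ (Fin d) =>
          χ (euclProj K (p.1 - η • g p.1 x - η • p.2)) :=
        hχ.comp (hP.comp ((measurable_fst.sub (((hg x hx).comp measurable_fst).const_smul η)).sub
          (measurable_snd.const_smul η)))
      exact h1.lintegral_prod_right'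
    have hmφ := hmeas _ (hS (Fin.last n)) hφ
    have hmψ := hmeas _ (hS' (Fin.last n)) hψ
    have hja : 0 ≤ (j : ℝ) * a := by positivity
    have hstep := fun u u' hu => lintegral_euclProj_le hc hK hne hαq hη ha hja hσ hφ hψ hdom
      (u := u) (u' := u') hu
    -- If the last input differs, both previous iterates have the same law and can be taken equal;
    -- only the gradient gap `ηΔ` is left. Otherwise the common step is contracted and the induction
    -- continues with `j + 1`.
    induction t using Fin.lastCases with
    | last =>
      have hinit : Fin.init S = Fin.init S' := funext fun i => hSS' _ (Fin.castSucc_lt_last i).ne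
      have h1 : n + 1 - (Fin.last n : ℕ) = 1 := by simp
      rw [h1] at hj ⊢
      rw [hinit, pow_one]
      have := isProbabilityMeasure_pnsgd hc hK hg η σ hw₀ (Fin.init S') fun i => hS' i.castSucc
      have h2 := ae_mem_pnsgd hc hK hg η σ hw₀ (Fin.init S') fun i => hS' i.castSucc
      refine (lintegral_mono_ae (h2.mono fun w hw => hstep _
        (w - η • g w (S' (Fin.last n))) ?_)).trans ?_
      · rw [sub_sub_sub_cancel_left, ← smul_sub, norm_smul, Real.norm_of_nonneg hη.le,
          norm_sub_rev]
        calc η * ‖g w (S (Fin.last n)) - g w (S' (Fin.last n))‖ ≤ η * Δ := by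
              gcongr; exact hΔ w hw
          _ ≤ _ := hj
          _ = _ := by push_cast; ring
      · rw [lintegral_const_mul _ (hmψ.pow_const _)]
        gcongr
        refine (lintegral_le_lintegral_rpow hαq.symm.lt _ (hmψ.pow_const _)).trans_eq ?_
        simp only [← ENNReal.rpow_mul, one_div, inv_mul_cancel₀ hq.ne', ENNReal.rpow_one]
    | cast t =>
      have hlast : S (Fin.last n) = S' (Fin.last n) := hSS' _ (Fin.castSucc_lt_last t).ne'
      have h1 : n + 1 - (t.castSucc : ℕ) = (n - t) + 1 := by
        rw [Fin.val_castSucc]; omega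
      rw [h1] at hj ⊢
      refine (ih t (Fin.init S) (Fin.init S') (fun i => hS i.castSucc) (fun i => hS' i.castSucc)
        (fun i hi => hSS' _ (by simpa using hi)) hΔ (j + 1) ?_ hmφ hmψ
        (C := C * ENNReal.ofReal (Real.exp ((α - 1) * (a / η) ^ 2 / (2 * σ ^ 2)))) ?_).trans_eq ?_
      · exact (hj.trans_eq (by push_cast; ring))
      · intro w hw w' hw' hww'
        refine hstep _ _ ?_
        rw [← hlast]
        refine (hcontr _ (hS _) w hw w' hw').trans (hww'.trans_eq ?_)
        push_cast
        ring
      · rw [pow_succ]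
        ring

theorem renyiDiv_pnsgd_le (hc : IsClosed K) (hK : Convex ℝ K) {X : Set 𝒳}
    {g : EuclideanSpace ℝ (Fin d) → 𝒳 → EuclideanSpace ℝ (Fin d)}
    (hg : ∀ x ∈ X, Measurable fun w => g w x) {η : ℝ} (hη : 0 < η)
    (hcontr : ∀ x ∈ X, ∀ w ∈ K, ∀ w' ∈ K,
      ‖(w - η • g w x) - (w' - η • g w' x)‖ ≤ ‖w - w'‖)
    {w₀ : EuclideanSpace ℝ (Fin d)} (hw₀ : w₀ ∈ K) {α : ℝ} (hα : 1 < α)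
    {σ Δ : ℝ} (hΔ0 : 0 ≤ Δ) (hσ : σ = 0 → Δ = 0) {n : ℕ} (t : Fin n) (S S' : Fin n → 𝒳)
    (hS : ∀ i, S i ∈ X) (hS' : ∀ i, S' i ∈ X) (hSS' : ∀ i, i ≠ t → S i = S' i)
    (hΔ : ∀ w ∈ K, ‖g w (S t) - g w (S' t)‖ ≤ Δ) :
    renyiDiv α (pnsgd K g η σ w₀ S) (pnsgd K g η σ w₀ S')
      ≤ ((α * Δ ^ 2 / (2 * σ ^ 2 * (n - t : ℕ)) : ℝ) : EReal) := by
  have hαq := Real.HolderConjugate.conjExponent hα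
  have hq := hαq.symm.pos
  have := isProbabilityMeasure_pnsgd hc hK hg η σ hw₀ S hS
  have := isProbabilityMeasure_pnsgd hc hK hg η σ hw₀ S' hS'
  have hm : (0 : ℝ) < (n - t : ℕ) := by exact_mod_cast Nat.sub_pos_of_lt t.2
  set m : ℕ := n - t
  have hH : HolderDominated α.conjExponent (ENNReal.ofReal (Real.exp
      (m * ((α - 1) * (η * Δ / m / η) ^ 2 / (2 * σ ^ 2))))) (pnsgd K g η σ w₀ S)
      (pnsgd K g η σ w₀ S') := fun φ hφ => by
    -- Equal shares `a = ηΔ/m`. Initially `j = 0`, `C = 1` and `ψ = φ^q`, so domination at distance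
    -- zero is an equality.
    have h1 := lintegral_pnsgd_le hc hK hg hη hcontr hw₀ hαq (σ := σ) (a := η * Δ / m)
      (by positivity) (fun h => by simp [hσ h]) t S S' hS hS' hSS' hΔ 0
      (by rw [Nat.cast_zero, zero_add, mul_div_cancel₀ _ hm.ne']) hφ (hφ.pow_const α.conjExponent)
      (C := 1) (fun w hw w' hw' hww' => by
        rw [Nat.cast_zero, zero_mul, norm_le_zero_iff, sub_eq_zero] at hww'
        rw [hww', ← ENNReal.rpow_mul, one_div, mul_inv_cancel₀ hq.ne', ENNReal.rpow_one, one_mul])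
    rwa [one_mul, ← ENNReal.ofReal_pow (Real.exp_pos _).le, ← Real.exp_nat_mul] at h1
  refine (hH.renyiDiv_le hαq).trans_eq ?_
  congr 1
  have h1 : α - 1 ≠ 0 := by linarith
  rcases eq_or_ne σ 0 with h0 | h0
  · simp [h0]
  · field_simp

end NoisySGD

/-! ### Privacy of projected noisy SGD -/

section Privacy

variable {𝒳 : Type*} {d : ℕ} {K : Set (EuclideanSpace ℝ (Fin d))} {X : Set 𝒳}
  {f : EuclideanSpace ℝ (Fin d) → 𝒳 → ℝ}
  {g : EuclideanSpace ℝ (Fin d) → 𝒳 → EuclideanSpace ℝ (Fin d)} {β : ℝ}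

theorem renyiDiv_pnsgd_le_of_isConvexSmoothFamily (hc : IsClosed K) (hK : Convex ℝ K) (hβ : 0 < β)
    (hfam : IsConvexSmoothFamily K X f g β) {η : ℝ} (hη : 0 < η) (hη2 : η ≤ 2 / β)
    {w₀ : EuclideanSpace ℝ (Fin d)} (hw₀ : w₀ ∈ K) {α : ℝ} (hα : 1 < α)
    {σ Δ : ℝ} (hΔ0 : 0 ≤ Δ) (hσ : σ = 0 → Δ = 0) {n : ℕ} (t : Fin n) (S S' : Fin n → 𝒳)
    (hS : ∀ i, S i ∈ X) (hS' : ∀ i, S' i ∈ X) (hSS' : ∀ i, i ≠ t → S i = S' i)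
    (hΔ : ∀ w ∈ K, ‖(vectorSpan ℝ K).starProjection (g w (S t) - g w (S' t))‖ ≤ Δ) :
    renyiDiv α (pnsgd K g η σ w₀ S) (pnsgd K g η σ w₀ S')
      ≤ ((α * Δ ^ 2 / (2 * σ ^ 2 * (n - t : ℕ)) : ℝ) : EReal) := by
  have hne : K.Nonempty := ⟨w₀, hw₀⟩
  set V := vectorSpan ℝ K with hV
  -- Precomposing with the projection makes the gradient field Lipschitz, hence measurable, on the
  -- whole space; keeping its tangential part makes the steps nonexpansive. Neither changes the run.
  set g' : EuclideanSpace ℝ (Fin d) → 𝒳 → EuclideanSpace ℝ (Fin d) :=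
    fun w x => V.starProjection (g (euclProj K w) x) with hg'
  have hg'K : ∀ w ∈ K, ∀ x, g' w x = V.starProjection (g w x) := fun w hw x => by
    simp only [hg', euclProj_eq_of_mem hc hK hw]
  have hrun : ∀ T : Fin n → 𝒳, (∀ i, T i ∈ X) → pnsgd K g η σ w₀ T = pnsgd K g' η σ w₀ T :=
    fun T hT => by
      refine congrArg (fun F => Measure.map F _) (funext fun z =>
        pnsgdRun_congr hc hK (fun w hw x _ z => ?_) hw₀ n T hT z)
      rw [hg'K w hw]
      have h1 : w - η • (g w x + z) = w - η • (V.starProjection (g w x) + z)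
          + -(η • (g w x - V.starProjection (g w x))) := by module
      rw [h1]
      refine euclProj_add_eq hc hK hne _ _ fun u hu u' hu' => ?_
      have h2 : u - u' ∈ V := vsub_mem_vectorSpan ℝ hu hu'
      rw [inner_neg_left, real_inner_smul_left, V.starProjection_inner_eq_zero _ _ h2, mul_zero,
        neg_zero]
  have hmeas : ∀ x ∈ X, Measurable fun w => g' w x := fun x hx => by
    refine (LipschitzWith.of_dist_le_mul (K := ⟨β, hβ.le⟩) fun w w' => ?_).continuous.measurable
    simp only [hg', dist_eq_norm]
    rw [← map_sub]
    refine (V.norm_starProjection_apply_le _).trans ((hfam.smooth x hx _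
      (euclProj_mem hc hK hne w) _ (euclProj_mem hc hK hne w')).trans ?_)
    exact mul_le_mul_of_nonneg_left (norm_euclProj_sub_le hc hK hne w w') hβ.le
  rw [hrun S hS, hrun S' hS']
  refine renyiDiv_pnsgd_le hc hK hmeas hη (fun x hx w hw w' hw' => ?_) hw₀ hα hΔ0 hσ t S S' hS hS'
    hSS' fun w hw => ?_
  · rw [hg'K w hw, hg'K w' hw']
    exact norm_gradient_step_sub_le hβ (hfam.convexOn x hx) (hfam.hasGradient x hx)
      (hfam.smooth x hx) hη hη2 hw hw'
  · rw [hg'K w hw, hg'K w hw, ← map_sub]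
    exact hΔ w hw

/-- With positions counted from `0`, `n - t` is the number of noise draws from the differing step
on, that step included. -/
theorem cast_sub_add_one_add_one {n : ℕ} (t : Fin n) :
    (n : ℝ) - ((t : ℝ) + 1) + 1 = (n - t : ℕ) := by
  rw [Nat.cast_sub t.2.le]
  ring

theorem renyiMDPAt_pnsgd [MetricSpace 𝒳] (hc : IsClosed K) (hK : Convex ℝ K) (hβ : 0 < β)
    (hfam : IsConvexSmoothFamily K X f g β) {n : ℕ} (t : Fin n) {α ε η : ℝ}
    {w₀ : EuclideanSpace ℝ (Fin d)} (hα : 1 < α) (hε : 0 < ε) (hη : 0 < η) (hη2 : η ≤ 2 / β)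
    (hw₀ : w₀ ∈ K) {L σ : ℝ} (hX : Bornology.IsBounded X) (hL : IsInputLipschitz K X g L)
    (hσ : mdpNoise α ε L (Metric.diam X) t ≤ σ ^ 2) : RenyiMDPAt X α ε t (pnsgd K g η σ w₀) := by
  intro S S' hS hS' hSS'
  have hm : (0 : ℝ) < (n - t : ℕ) := by exact_mod_cast Nat.sub_pos_of_lt t.2
  rw [mdpNoise, cast_sub_add_one_add_one] at hσ
  set m : ℝ := ((n - t : ℕ) : ℝ)
  have hdist : datasetDist S S' = dist (S t) (S' t) := by
    refine Finset.sum_eq_single t (fun i _ hi => ?_) (fun h => absurd (Finset.mem_univ t) h)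
    rw [hSS' i hi, dist_self]
  rw [hdist]
  set ρ := dist (S t) (S' t)
  have hρ0 : 0 ≤ ρ := dist_nonneg
  have hρ : ρ ≤ Metric.diam X := Metric.dist_le_diam_of_mem hX (hS t) (hS' t)
  have hL0 := hL.1
  -- The diameter enters here: it replaces one of the two factors `ρ` in `Δ² = L²ρ²`, leaving a
  -- bound linear in `ρ`.
  have h1 : 2 * α * L ^ 2 * ρ ≤ σ ^ 2 * (ε * m) := by
    rw [div_le_iff₀ (by positivity)] at hσ
    refine le_trans ?_ hσ
    gcongr
  refine (renyiDiv_pnsgd_le_of_isConvexSmoothFamily hc hK hβ hfam hη hη2 hw₀ hα (σ := σ)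
    (Δ := L * ρ) (by positivity) (fun h0 => ?_) t S S' hS hS' hSS' fun w hw =>
      ((vectorSpan ℝ K).norm_starProjection_apply_le _).trans
        (hL.2 w hw _ (hS t) _ (hS' t))).trans ?_
  · have h2 : L ^ 2 * ρ = 0 := by
      have h3 : 0 ≤ L ^ 2 * ρ := by positivity
      rw [h0] at h1
      nlinarith
    rcases mul_eq_zero.1 h2 with h | h
    · rw [pow_eq_zero_iff two_ne_zero] at h
      rw [h, zero_mul]
    · rw [h, mul_zero]
  · rw [EReal.coe_le_coe_iff]
    refine div_le_of_le_mul₀ (by positivity) (by positivity) ?_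
    have h2 : 2 * α * L ^ 2 * ρ * ρ ≤ σ ^ 2 * (ε * m) * ρ := by gcongr
    have h3 : 0 ≤ α * L ^ 2 * ρ ^ 2 := by positivity
    nlinarith

theorem renyiDPAt_pnsgd (hc : IsClosed K) (hK : Convex ℝ K) (hβ : 0 < β)
    (hfam : IsConvexSmoothFamily K X f g β) {n : ℕ} (t : Fin n) {α ε η : ℝ}
    {w₀ : EuclideanSpace ℝ (Fin d)} (hα : 1 < α) (hε : 0 < ε) (hη : 0 < η) (hη2 : η ≤ 2 / β)
    (hw₀ : w₀ ∈ K) {G σ : ℝ} (hG : IsLipschitzFamily K X f G)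
    (hσ : rdpNoise α ε G t ≤ σ ^ 2) : RenyiDPAt X α ε t (pnsgd K g η σ w₀) := by
  intro S S' hS hS' hSS'
  have hm : (0 : ℝ) < (n - t : ℕ) := by exact_mod_cast Nat.sub_pos_of_lt t.2
  rw [rdpNoise, cast_sub_add_one_add_one] at hσ
  set m : ℝ := ((n - t : ℕ) : ℝ)
  have hG0 := hG.1
  have hgrad : ∀ x ∈ X, ∀ w ∈ K, ‖(vectorSpan ℝ K).starProjection (g w x)‖ ≤ G :=
    fun x hx w hw => norm_starProjection_gradient_le (hfam.convexOn x hx) (hfam.hasGradient x hx)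
      (hfam.smooth x hx) hG0 (hG.2 x hx) hw
  rw [div_le_iff₀ (by positivity)] at hσ
  refine (renyiDiv_pnsgd_le_of_isConvexSmoothFamily hc hK hβ hfam hη hη2 hw₀ hα (σ := σ)
    -- Two tangential gradients of length at most `G` differ by at most `2G`; then `αΔ²/(2σ²m) =
    -- 2αG²/(σ²m)`, which matches the noise level exactly.
    (Δ := 2 * G) (by positivity) (fun h0 => ?_) t S S' hS hS' hSS' fun w hw => ?_).trans ?_
  · have h2 : G ^ 2 = 0 := by
      have h3 : 0 ≤ G ^ 2 := by positivity
      rw [h0] at hσ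
      nlinarith
    rw [pow_eq_zero_iff two_ne_zero] at h2
    rw [h2, mul_zero]
  · rw [map_sub]
    have h1 := norm_sub_le ((vectorSpan ℝ K).starProjection (g w (S t)))
      ((vectorSpan ℝ K).starProjection (g w (S' t)))
    linarith [hgrad _ (hS t) w hw, hgrad _ (hS' t) w hw]
  · rw [EReal.coe_le_coe_iff]
    refine div_le_of_le_mul₀ (by positivity) hε.le ?_
    linarith

end Privacy

theorem mdpNoise_lt_rdpNoise_iff {n : ℕ} {α ε : ℝ} (hα : 1 < α) (hε : 0 < ε) (L D G : ℝ)
    (t : Fin n) : mdpNoise α ε L D t < rdpNoise α ε G t ↔ L ^ 2 * D < G ^ 2 := by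
  have hm : (0 : ℝ) < (n - t : ℕ) := by exact_mod_cast Nat.sub_pos_of_lt t.2
  rw [mdpNoise, rdpNoise, cast_sub_add_one_add_one, div_lt_div_iff_of_pos_right (by positivity),
    mul_assoc (2 * α), mul_lt_mul_iff_right₀ (by positivity)]

/-! ### The squared distance family -/

section SquaredDistance

variable {d : ℕ} {X : Set (EuclideanSpace ℝ (Fin d))}

theorem hasGradientAt_half_norm_sub_sq (w x : EuclideanSpace ℝ (Fin d)) :
    HasGradientAt (fun w => 1 / 2 * ‖w - x‖ ^ 2) (w - x) w := by
  rw [hasGradientAt_iff_hasFDerivAt]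
  have h1 := (((hasFDerivAt_id w).sub_const x).norm_sq).const_mul (1 / 2 : ℝ)
  refine h1.congr_fderiv ?_
  ext v
  simp

theorem convexOn_half_norm_sub_sq {K : Set (EuclideanSpace ℝ (Fin d))} (hK : Convex ℝ K)
    (x : EuclideanSpace ℝ (Fin d)) : ConvexOn ℝ K fun w => 1 / 2 * ‖w - x‖ ^ 2 := by
  have h1 : ConvexOn ℝ K fun w => ‖w - x‖ := by
    have h2 := (convexOn_univ_norm (E := EuclideanSpace ℝ (Fin d))).translate_left (-x)
    simp only [← sub_eq_add_neg] at h2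
    exact h2.subset (Set.subset_univ _) hK
  simpa [smul_eq_mul] using (h1.pow (fun w _ => norm_nonneg _) 2).smul
    (by norm_num : (0 : ℝ) ≤ 1 / 2)

/-- The closed ball of radius `diam X` around `x` is closed, convex and contains `X`. -/
theorem norm_sub_le_diam_of_mem_closedConvexHull (hX : Bornology.IsBounded X)
    {w x : EuclideanSpace ℝ (Fin d)} (hw : w ∈ closedConvexHull ℝ X) (hx : x ∈ X) :
    ‖w - x‖ ≤ Metric.diam X := by
  have h1 : closedConvexHull ℝ X ⊆ Metric.closedBall x (Metric.diam X) :=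
    closedConvexHull_min (fun y hy => Metric.dist_le_diam_of_mem hX hy hx)
      (convex_closedBall _ _) Metric.isClosed_closedBall
  simpa [dist_eq_norm] using h1 hw

theorem isConvexSmoothFamily_half_norm_sub_sq {K : Set (EuclideanSpace ℝ (Fin d))}
    (hK : Convex ℝ K) (X : Set (EuclideanSpace ℝ (Fin d))) :
    IsConvexSmoothFamily K X (fun w x => 1 / 2 * ‖w - x‖ ^ 2) (fun w x => w - x) 1 where
  convexOn x _ := convexOn_half_norm_sub_sq hK x
  hasGradient x _ w _ := (hasGradientAt_half_norm_sub_sq w x).hasFDerivAt.hasFDerivWithinAt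
  smooth x _ w _ w' _ := by simp

theorem isLeast_isLipschitzFamily_half_norm_sub_sq (hX : Bornology.IsBounded X) :
    IsLeast {G : ℝ | IsLipschitzFamily (closedConvexHull ℝ X) X
      (fun w x => 1 / 2 * ‖w - x‖ ^ 2) G} (Metric.diam X) := by
  refine ⟨⟨Metric.diam_nonneg, fun x hx w hw w' hw' => ?_⟩, fun G hG => ?_⟩
  · have h1 := norm_sub_le_diam_of_mem_closedConvexHull hX hw hx
    have h2 := norm_sub_le_diam_of_mem_closedConvexHull hX hw' hx
    have h3 : 1 / 2 * ‖w - x‖ ^ 2 - 1 / 2 * ‖w' - x‖ ^ 2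
        = (‖w - x‖ + ‖w' - x‖) / 2 * (‖w - x‖ - ‖w' - x‖) := by ring
    have h4 : |‖w - x‖ - ‖w' - x‖| ≤ ‖w - w'‖ := by
      simpa using abs_norm_sub_norm_le (w - x) (w' - x)
    rw [h3, abs_mul, abs_of_nonneg (by positivity)]
    refine mul_le_mul ?_ h4 (abs_nonneg _) Metric.diam_nonneg
    linarith
  · refine Metric.diam_le_of_forall_dist_le hG.1 fun y hy x hx => ?_
    rw [dist_eq_norm]
    rcases (norm_nonneg (y - x)).eq_or_lt with h0 | h0
    · rw [← h0]; exact hG.1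
    have hyK : y ∈ closedConvexHull ℝ X := subset_closedConvexHull hy
    have hxK : x ∈ closedConvexHull ℝ X := subset_closedConvexHull hx
    -- Moving from `y` towards `x` by the fraction `s` gives the difference quotient `‖y - x‖ (1 -
    -- s/2)`, which tends to `‖y - x‖`.
    refine le_of_forall_le_add_mul (M := ‖y - x‖) fun s hs hs1 => ?_
    have h1 := convex_closedConvexHull.add_smul_sub_mem hyK hxK ⟨hs.le, hs1⟩
    have h2 := (le_abs_self _).trans (hG.2 x hx y hyK _ h1)
    have h3 : y + s • (x - y) - x = (1 - s) • (y - x) := by module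
    have h4 : y - (y + s • (x - y)) = s • (y - x) := by module
    beta_reduce at h2
    rw [h3, h4, norm_smul, norm_smul, Real.norm_of_nonneg hs.le,
      Real.norm_of_nonneg (by linarith)] at h2
    have h5 : s * ‖y - x‖ * (‖y - x‖ * (1 - s / 2)) ≤ s * ‖y - x‖ * G := by nlinarith
    have h6 := le_of_mul_le_mul_left h5 (by positivity)
    nlinarith

end SquaredDistance

/-! ### Assembly of the four statements -/

theorem mainTheorem6 {𝒳 : Type*} [MetricSpace 𝒳] {d : ℕ} :
    -- the two noise requirements for general families, and the class on which the first is lower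
    (∀ (K : Set (EuclideanSpace ℝ (Fin d))) (X : Set 𝒳)
      (f : EuclideanSpace ℝ (Fin d) → 𝒳 → ℝ)
      (g : EuclideanSpace ℝ (Fin d) → 𝒳 → EuclideanSpace ℝ (Fin d)) (β : ℝ),
      IsClosed K → Convex ℝ K → 0 < β → IsConvexSmoothFamily K X f g β →
      ∀ (n : ℕ) (t : Fin n) (α ε η : ℝ) (w₀ : EuclideanSpace ℝ (Fin d)),
        1 < α → 0 < ε → 0 < η → η ≤ 2 / β → w₀ ∈ K →
        (∀ L σ : ℝ, Bornology.IsBounded X → IsInputLipschitz K X g L →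
          mdpNoise α ε L (Metric.diam X) t ≤ σ ^ 2 →
            RenyiMDPAt X α ε t (pnsgd K g η σ w₀)) ∧
        (∀ G σ : ℝ, IsLipschitzFamily K X f G → rdpNoise α ε G t ≤ σ ^ 2 →
            RenyiDPAt X α ε t (pnsgd K g η σ w₀)) ∧
        (∀ L G : ℝ, Bornology.IsBounded X → IsInputLipschitz K X g L →
          IsLipschitzFamily K X f G →
          (mdpNoise α ε L (Metric.diam X) t < rdpNoise α ε G t ↔
            L ^ 2 * Metric.diam X < G ^ 2)) ∧
        (∀ L c : ℝ, Bornology.IsBounded X → IsInputLipschitz K X g L → 0 < c →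
          (∀ G, IsLipschitzFamily K X f G → c * Metric.diam X ≤ G) →
          (L / c) ^ 2 < Metric.diam X →
            ∀ G, IsLipschitzFamily K X f G →
              mdpNoise α ε L (Metric.diam X) t < rdpNoise α ε G t)) ∧
    -- the family `f(w, x) = ‖w - x‖² / 2`, with parameters in the closed convex hull of `X`
    (∀ (X K : Set (EuclideanSpace ℝ (Fin d)))
      (f : EuclideanSpace ℝ (Fin d) → EuclideanSpace ℝ (Fin d) → ℝ)
      (g : EuclideanSpace ℝ (Fin d) → EuclideanSpace ℝ (Fin d) → EuclideanSpace ℝ (Fin d)),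
      Bornology.IsBounded X → K = closedConvexHull ℝ X →
      (∀ w x, f w x = 1 / 2 * ‖w - x‖ ^ 2) → (∀ w x, g w x = w - x) →
        IsConvexSmoothFamily K X f g 1 ∧
        IsInputLipschitz K X g 1 ∧
        IsLeast {G : ℝ | IsLipschitzFamily K X f G} (Metric.diam X) ∧
        ∀ (n : ℕ) (t : Fin n) (α ε : ℝ), 1 < α → 0 < ε →
          mdpNoise α ε 1 (Metric.diam X) t =
            2 * α * Metric.diam X / (ε * ((n : ℝ) - ((t : ℝ) + 1) + 1)) ∧
          rdpNoise α ε (Metric.diam X) t =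
            2 * α * Metric.diam X ^ 2 / (ε * ((n : ℝ) - ((t : ℝ) + 1) + 1)) ∧
          rdpNoise α ε (Metric.diam X) t =
            Metric.diam X * mdpNoise α ε 1 (Metric.diam X) t ∧
          (mdpNoise α ε 1 (Metric.diam X) t < rdpNoise α ε (Metric.diam X) t ↔
            1 < Metric.diam X) ∧
          ∀ (η σ : ℝ) (w₀ : EuclideanSpace ℝ (Fin d)), 0 < η → η ≤ 2 → w₀ ∈ K →
            (mdpNoise α ε 1 (Metric.diam X) t ≤ σ ^ 2 →
              RenyiMDPAt X α ε t (pnsgd K g η σ w₀)) ∧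
            (rdpNoise α ε (Metric.diam X) t ≤ σ ^ 2 →
              RenyiDPAt X α ε t (pnsgd K g η σ w₀))) := by
  refine ⟨?_, ?_⟩
  · intro K X f g β hc hK hβ hfam n t α ε η w₀ hα hε hη hη2 hw₀
    refine ⟨fun L σ hX hL hσ => renyiMDPAt_pnsgd hc hK hβ hfam t hα hε hη hη2 hw₀ hX hL hσ,
      fun G σ hG hσ => renyiDPAt_pnsgd hc hK hβ hfam t hα hε hη hη2 hw₀ hG hσ,
      fun L G _ _ _ => mdpNoise_lt_rdpNoise_iff hα hε L _ G t,
      fun L c _ _ hc0 hscale hdiam G hG => ?_⟩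
    rw [mdpNoise_lt_rdpNoise_iff hα hε]
    have h1 : 0 < Metric.diam X := (sq_nonneg _).trans_lt hdiam
    rw [div_pow, div_lt_iff₀ (by positivity)] at hdiam
    calc L ^ 2 * Metric.diam X < Metric.diam X * c ^ 2 * Metric.diam X := by gcongr
      _ = (c * Metric.diam X) ^ 2 := by ring
      _ ≤ G ^ 2 := by gcongr; exact hscale G hG
  · intro X K f g hX hKX hf hg
    obtain rfl : f = fun w x => 1 / 2 * ‖w - x‖ ^ 2 := funext₂ hf
    obtain rfl : g = fun w x => w - x := funext₂ hg
    subst hKX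
    have hK : Convex ℝ (closedConvexHull ℝ X) := convex_closedConvexHull
    have hc : IsClosed (closedConvexHull ℝ X : Set (EuclideanSpace ℝ (Fin d))) :=
      isClosed_closedConvexHull
    have hfam := isConvexSmoothFamily_half_norm_sub_sq hK X
    have hL : IsInputLipschitz (closedConvexHull ℝ X) X
        (fun w x : EuclideanSpace ℝ (Fin d) => w - x) 1 :=
      ⟨zero_le_one, fun w _ x _ x' _ => by
        rw [sub_sub_sub_cancel_left, one_mul, dist_comm, dist_eq_norm]⟩
    have hG := isLeast_isLipschitzFamily_half_norm_sub_sq hX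
    refine ⟨hfam, hL, hG, fun n t α ε hα hε => ⟨?_, rfl, ?_, ?_, fun η σ w₀ hη hη2 hw₀ =>
      ⟨fun hσ => renyiMDPAt_pnsgd hc hK one_pos hfam t hα hε hη (by simpa using hη2) hw₀ hX hL hσ,
      fun hσ => renyiDPAt_pnsgd hc hK one_pos hfam t hα hε hη (by simpa using hη2) hw₀ hG.1 hσ⟩⟩⟩
    · rw [mdpNoise]; ring
    · rw [mdpNoise, rdpNoise]; ring
    · rw [mdpNoise_lt_rdpNoise_iff hα hε]
      have h0 : 0 ≤ Metric.diam X := Metric.diam_nonneg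
      constructor <;> intro h <;> nlinarith
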